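/- Let $\mathbb{Z}\wr\mathbb{Z}$ be the group of pairs $(y,b)$ with $y\in\mathbb{Z}[X^{\pm}]$ (integer Laurent polynomials) and $b\in\mathbb{Z}$, with multiplication $(y,b)(y',b')=(y+X^{b}y',\,b+b')$. Let $\mathcal{G}=\{(y_a,b_a)\mid a\in A\}$ be a finite family of elements of $\mathbb{Z}\wr\mathbb{Z}$, let $\langle\mathcal{G}\rangle$ be the semigroup it generates (the products of non-empty words), and put $$I=\{i\in A\mid b_i>0\},\qquad J=\{j\in A\mid b_j<0\},\qquad K=\{k\in A\mid b_k=0\}.$$ Assume $I\neq\emptyset$ and $J\neq\emptyset$, and let $d=\gcd\{b_a\mid a\in I\cup J\}\geq 1$. For $(i,j)\in I\times J$ let $$h_{(i,j)}=\frac{y_i}{1+X^d+\cdots+X^{b_i-d}}+\frac{y_j}{X^{-d}+X^{-2d}+\cdots+X^{-|b_j|}}\in\mathbb{Q}(X).$$ Let $h_{(i,j),m}\in\mathbb{Q}(X)$ and $y_{k,m}\in\mathbb{Q}[X^{\pm}]$, for $(i,j)\in I\times J$, $k\in K$ and $0\le m<d$, be the (unique) elements with $$h_{(i,j)}=\sum_{m=0}^{d-1}h_{(i,j),m}(X^d)\,X^m,\qquad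 y_k=\sum_{m=0}^{d-1}y_{k,m}(X^d)\,X^m.$$ A set $S\subseteq I\times J$ is called double-full if for every $i\in I$ there is $j\in J$ with $(i,j)\in S$, and for every $j\in J$ there is $i\in I$ with $(i,j)\in S$. Let $\mathbb{R}_{\ge0}[X^{\pm}]^*$ be the set of nonzero real Laurent polynomials with nonnegative coefficients. For a real Laurent polynomial $f\ne0$ let $\deg_+(f)$ and $\deg_-(f)$ be the largest and the smallest exponent occurring in $f$; let $\deg_+(0)=-\infty$ and $\deg_-(0)=+\infty$. Then $\langle\mathcal{G}\rangle$ is a group if and only if there exist a double-full set $S\subseteq I\times J$ and Laurent polynomials $f_S$, $f_{(i,j)}$ $((i,j)\in S)$, $f_k$ $(k\in K)$ in $\mathbb{R}_{\ge0}[X^{\pm}]^*$, and $f_K\in\mathbb{R}_{\ge0}[X^{\pm}]^*$ (or $f_K=0$ in case $K=\emptyset$), such that (i) the following equations hold over $\mathbb{R}(X)$: $$\sum_{(i,j)\in S}f_{(i,j)}\,h_{(i,j),m}+\sum_{k\in K}f_k\,y_{k,m}=0\quad(m=0,\ldots,d-1),\qquad f_S=\sum_{(i,j)\in S}f_{(i,j)},\qquad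 f_K=\sum_{k\in K}f_k;$$ (ii) $\deg_+(f_S)+1\geq\deg_+(f_K)$; (iii) $\deg_-(f_S)\leq\deg_-(f_K)$. -/

import Mathlib

/-! ### The wreath product `ℤ ≀ ℤ` -/

/-- The wreath product `ℤ ≀ ℤ`: pairs `(y, b)` with `y ∈ ℤ[X^±]` and `b ∈ ℤ`. -/
@[ext]
structure ZWrZ where
  y : LaurentPolynomial ℤ
  b : ℤ

namespace ZWrZ

/-- `(y, b) * (y', b') = (y + X ^ b * y', b + b')`. -/
noncomputable instance : Mul ZWrZ :=
  ⟨fun g g' => ⟨g.y + LaurentPolynomial.T g.b * g'.y, g.b + g'.b⟩⟩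

/-- The neutral element is `(0, 0)`. -/
noncomputable instance : One ZWrZ := ⟨⟨0, 0⟩⟩

/-- `(y, b)⁻¹ = (-X ^ (-b) * y, -b)`. -/
noncomputable instance : Inv ZWrZ :=
  ⟨fun g => ⟨-(LaurentPolynomial.T (-g.b) * g.y), -g.b⟩⟩

theorem mul_def (g g' : ZWrZ) :
    g * g' = ⟨g.y + LaurentPolynomial.T g.b * g'.y, g.b + g'.b⟩ := rfl

theorem one_def : (1 : ZWrZ) = ⟨0, 0⟩ := rfl

theorem inv_def (g : ZWrZ) : g⁻¹ = ⟨-(LaurentPolynomial.T (-g.b) * g.y), -g.b⟩ := rfl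

noncomputable instance : Group ZWrZ :=
  Group.ofLeftAxioms
    (by
      intro g g' g''
      simp only [mul_def, LaurentPolynomial.T_add]
      ext1
      · simp only; ring
      · simp only; ring)
    (by intro g; simp [mul_def, one_def])
    (by intro g; simp [mul_def, one_def, inv_def])

/-- The semigroup `⟨G⟩` generated by the family `G = {(y a, b a) | a ∈ A}`
(products of non-empty words). -/
noncomputable def generated {A : Type*} (y : A → LaurentPolynomial ℤ) (b : A → ℤ) : Subsemigroup ZWrZ :=
  Subsemigroup.closure (Set.range fun a => (⟨y a, b a⟩ : ZWrZ))

/-- The multiplication of the semigroup `H` makes it a group: there are a neutral element and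
inverses, both inside `H`. -/
def IsGroupSemigroup {M : Type*} [Mul M] (H : Subsemigroup M) : Prop :=
  ∃ e ∈ H, ∀ x ∈ H, e * x = x ∧ x * e = x ∧ ∃ x' ∈ H, x' * x = e ∧ x * x' = e

/-! ### Laurent polynomials and rational functions -/

/-- `f ∈ ℝ≥0[X^±]*`: a nonzero Laurent polynomial with nonnegative real coefficients. -/
def IsPosLaurent (f : LaurentPolynomial ℝ) : Prop :=
  f ≠ 0 ∧ ∀ n : ℤ, 0 ≤ f.coeff n

/-- The negative degree, with `degMinus 0 = +∞`. The positive degree, with value `-∞` at `0`, is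
`LaurentPolynomial.degree`. -/
def degMinus (f : LaurentPolynomial ℝ) : WithTop ℤ := f.coeff.support.min

/-- The indeterminate `X` as a unit of `F(X)`. -/
noncomputable def ratX (F : Type*) [Field F] : (RatFunc F)ˣ :=
  Units.mk0 RatFunc.X RatFunc.X_ne_zero

/-- The canonical ring homomorphism `R[X^±] → F(X)`, for `F` an `R`-algebra. -/
noncomputable def toRat (F : Type*) [Field F] {R : Type*} [CommSemiring R] [Algebra R F] :
    LaurentPolynomial R →+* RatFunc F :=
  LaurentPolynomial.eval₂ (RatFunc.C.comp (algebraMap R F)) (ratX F)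

/-- The inclusion `ℚ(X) → ℝ(X)`. -/
noncomputable def ratToReal : RatFunc ℚ →+* RatFunc ℝ :=
  RatFunc.mapRingHom (Polynomial.mapRingHom (algebraMap ℚ ℝ))
    (nonZeroDivisors_le_comap_nonZeroDivisors_of_injective _
      (Polynomial.map_injective _ (algebraMap ℚ ℝ).injective))

/-- The substitution `r(X) ↦ r(X ^ d)` on `ℚ(X)` (for `d ≥ 1`). -/
noncomputable def substPow (d : ℕ) (r : RatFunc ℚ) : RatFunc ℚ :=
  r.eval RatFunc.C (RatFunc.X ^ d)

/-- `resPart d m f = ∑ₙ aₙ X ^ n`, where `aₙ` is the coefficient of `X ^ (d n + m)` in `f`. -/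
noncomputable def resPart (d m : ℕ) (f : LaurentPolynomial ℤ) : LaurentPolynomial ℤ :=
  f.coeff.sum fun n a =>
    if n % (d : ℤ) = m then LaurentPolynomial.C a * LaurentPolynomial.T (n / (d : ℤ)) else 0

/-! ### The data attached to the generators `(y a, b a)`, `a ∈ A` -/

section Data

variable {A : Type*} [Fintype A] (y : A → LaurentPolynomial ℤ) (b : A → ℤ)

/-- `I = {i | b i > 0}`. -/
def idxI : Finset A := Finset.univ.filter fun a => 0 < b a

/-- `J = {j | b j < 0}`. -/
def idxJ : Finset A := Finset.univ.filter fun a => b a < 0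

/-- `K = {k | b k = 0}`. -/
def idxK : Finset A := Finset.univ.filter fun a => b a = 0

/-- `d = gcd {b a | a ∈ I ∪ J}`; note that `I ∪ J = {a | b a ≠ 0}`. -/
def stepGcd : ℕ := (Finset.univ.filter fun a => b a ≠ 0).gcd fun a => (b a).natAbs

/-- `S ⊆ I × J` is double-full. -/
def DoubleFull (S : Finset (A × A)) : Prop :=
  S ⊆ idxI b ×ˢ idxJ b ∧ (∀ i ∈ idxI b, ∃ j ∈ idxJ b, (i, j) ∈ S) ∧
    ∀ j ∈ idxJ b, ∃ i ∈ idxI b, (i, j) ∈ S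

/-- The rational function `h_{(i,j)}`, that is
`y i / (1 + X ^ d + ⋯ + X ^ (b i - d)) + y j / (X ^ (-d) + X ^ (-2 d) + ⋯ + X ^ (-|b j|))`. -/
noncomputable def hFun (i j : A) : RatFunc ℚ :=
  toRat ℚ (y i) /
      ∑ t ∈ Finset.range ((b i).natAbs / stepGcd b), (RatFunc.X : RatFunc ℚ) ^ (stepGcd b * t) +
    toRat ℚ (y j) /
      ∑ t ∈ Finset.Icc 1 ((b j).natAbs / stepGcd b),
        (RatFunc.X : RatFunc ℚ) ^ (-((stepGcd b * t : ℕ) : ℤ))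

/-- The component `h_{(i,j),m}` of `h_{(i,j)}`: for `i ∈ I` and `j ∈ J` these are the rational
functions with `h_{(i,j)} = ∑_{m < d} h_{(i,j),m}(X ^ d) * X ^ m`, see `hFun_eq_sum`. -/
noncomputable def hRes (i j : A) (m : ℕ) : RatFunc ℚ :=
  toRat ℚ (resPart (stepGcd b) m (y i)) /
      ∑ t ∈ Finset.range ((b i).natAbs / stepGcd b), (RatFunc.X : RatFunc ℚ) ^ t +
    toRat ℚ (resPart (stepGcd b) m (y j)) /
      ∑ t ∈ Finset.Icc 1 ((b j).natAbs / stepGcd b), (RatFunc.X : RatFunc ℚ) ^ (-(t : ℤ))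

/-- The component `y_{k,m}` of `y k`: these are the Laurent polynomials with
`y k = ∑_{m < d} y_{k,m}(X ^ d) * X ^ m`, see `toRat_eq_sum`. -/
noncomputable def yRes (k : A) (m : ℕ) : RatFunc ℚ :=
  toRat ℚ (resPart (stepGcd b) m (y k))

end Data

/-! ### The decompositions by residues modulo `d` -/

theorem toRat_single (n : ℤ) (a : ℤ) :
    toRat ℚ (LaurentPolynomial.C a * LaurentPolynomial.T n) =
      RatFunc.C (a : ℚ) * (RatFunc.X : RatFunc ℚ) ^ n := by
  simp only [toRat, LaurentPolynomial.eval₂_C_mul_T]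
  simp [ratX]

theorem substPow_den_ne_zero {d : ℕ} (hd : 0 < d) {p : Polynomial ℚ} (hp : p ≠ 0) :
    Polynomial.eval₂ (RatFunc.C : ℚ →+* RatFunc ℚ) (RatFunc.X ^ d) p ≠ 0 := by
  have h : Polynomial.eval₂ (RatFunc.C : ℚ →+* RatFunc ℚ) (RatFunc.X ^ d) p =
      algebraMap (Polynomial ℚ) (RatFunc ℚ) (Polynomial.expand ℚ d p) := by
    rw [Polynomial.expand_eq_sum, Polynomial.eval₂_eq_sum, Polynomial.sum_def, Polynomial.sum_def,
      map_sum]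
    simp
  rw [h]
  simpa using (Polynomial.expand_ne_zero hd).2 hp

theorem substPow_add {d : ℕ} (hd : 0 < d) (r s : RatFunc ℚ) :
    substPow d (r + s) = substPow d r + substPow d s :=
  RatFunc.eval_add _ _ (substPow_den_ne_zero hd (RatFunc.denom_ne_zero r))
    (substPow_den_ne_zero hd (RatFunc.denom_ne_zero s))

theorem substPow_mul {d : ℕ} (hd : 0 < d) (r s : RatFunc ℚ) :
    substPow d (r * s) = substPow d r * substPow d s :=
  RatFunc.eval_mul _ _ (substPow_den_ne_zero hd (RatFunc.denom_ne_zero r))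
    (substPow_den_ne_zero hd (RatFunc.denom_ne_zero s))

/-- For `d ≥ 1` the substitution `X ↦ X ^ d` as a ring homomorphism. -/
noncomputable def substPowHom {d : ℕ} (hd : 0 < d) : RatFunc ℚ →+* RatFunc ℚ where
  toFun := substPow d
  map_one' := RatFunc.eval_one _ _
  map_mul' := substPow_mul hd
  map_zero' := RatFunc.eval_zero _ _
  map_add' := substPow_add hd

theorem substPowHom_apply {d : ℕ} (hd : 0 < d) (r : RatFunc ℚ) :
    substPowHom hd r = substPow d r := rfl

theorem substPowHom_X {d : ℕ} (hd : 0 < d) :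
    substPowHom hd (RatFunc.X : RatFunc ℚ) = RatFunc.X ^ d := RatFunc.eval_X _ _

theorem substPowHom_C {d : ℕ} (hd : 0 < d) (a : ℚ) :
    substPowHom hd (RatFunc.C a) = RatFunc.C a := RatFunc.eval_C _ _

/-- `f = ∑_{m < d} f_m(X ^ d) * X ^ m`. -/
theorem toRat_eq_sum {d : ℕ} (hd : 0 < d) (f : LaurentPolynomial ℤ) :
    toRat ℚ f =
      ∑ m ∈ Finset.range d, substPow d (toRat ℚ (resPart d m f)) * RatFunc.X ^ m := by
  have hf : f = f.coeff.sum fun n a => LaurentPolynomial.C a * LaurentPolynomial.T n := by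
    simp_rw [← LaurentPolynomial.single_eq_C_mul_T]
    exact (AddMonoidAlgebra.sum_coeff_single f).symm
  conv_lhs => rw [hf]
  simp only [resPart, Finsupp.sum, ← substPowHom_apply hd, map_sum, Finset.sum_mul]
  rw [Finset.sum_comm]
  refine Finset.sum_congr rfl fun n _ => ?_
  have hd' : (0 : ℤ) < d := by exact_mod_cast hd
  have h0 := Int.emod_nonneg n hd'.ne'
  have h1 := Int.emod_lt_of_pos n hd'
  rw [Finset.sum_eq_single (n % (d : ℤ)).toNat]
  · rw [if_pos (by rw [Int.toNat_of_nonneg h0]), toRat_single, toRat_single, map_mul,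
      substPowHom_C, map_zpow₀, substPowHom_X, mul_assoc, ← zpow_natCast, ← zpow_mul,
      ← zpow_natCast, ← zpow_add₀ RatFunc.X_ne_zero, Int.toNat_of_nonneg h0,
      Int.mul_ediv_add_emod]
  · intro m _ hm
    rw [if_neg (by omega)]
    simp
  · intro h
    exact absurd (Finset.mem_range.2 (by omega)) h

/-- `h_{(i,j)} = ∑_{m < d} h_{(i,j),m}(X ^ d) * X ^ m`. -/
theorem hFun_eq_sum {A : Type*} [Fintype A] (y : A → LaurentPolynomial ℤ) (b : A → ℤ) (i j : A)
    (hd : 0 < stepGcd b) :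
    hFun y b i j =
      ∑ m ∈ Finset.range (stepGcd b), substPow (stepGcd b) (hRes y b i j m) * RatFunc.X ^ m := by
  simp only [hFun, hRes, ← substPowHom_apply hd, map_add, map_div₀, map_sum, map_pow, map_zpow₀,
    substPowHom_X, add_mul, Finset.sum_add_distrib]
  rw [toRat_eq_sum hd (y i), toRat_eq_sum hd (y j), Finset.sum_div, Finset.sum_div]
  simp only [← substPowHom_apply hd]
  congr 1
  · refine Finset.sum_congr rfl fun m _ => ?_
    simp only [← pow_mul]
    ring
  · refine Finset.sum_congr rfl fun m _ => ?_
    have h : ∀ t : ℕ, (RatFunc.X : RatFunc ℚ) ^ (-((stepGcd b * t : ℕ) : ℤ)) =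
        (RatFunc.X ^ stepGcd b) ^ (-(t : ℤ)) := fun t => by
      rw [← zpow_natCast, ← zpow_mul]; push_cast; ring_nf
    simp only [h]
    ring

theorem stepGcd_pos {A : Type*} [Fintype A] {b : A → ℤ} (h : (idxI b).Nonempty) :
    0 < stepGcd b := by
  obtain ⟨i, hi⟩ := h
  have hi' : b i ≠ 0 := by
    simp only [idxI, Finset.mem_filter] at hi
    omega
  refine Nat.pos_of_ne_zero fun h0 => ?_
  have := Finset.gcd_eq_zero_iff.1 h0 i (by simpa using hi')
  omega

end ZWrZ

/-! A finitely generated subsemigroup of a group is a group exactly when some word using every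
generator equals 1 (`isGroupSemigroup_closure_iff`). Write `b a = d * c a`. A word is then a walk on
ℤ, the letter `a` read at position `v` being an edge `(v, a)` from `v` to `v + c a`. The product is
1 iff the walk is closed and, for each residue `m < d`, the sum of `X ^ v * y_{a,m}` over its edges
vanishes (`exists_word_iff_exists_isWalk`). Only the multiset of edges matters for this sum, and by
Euler's theorem a nonempty multiset of edges is a closed walk iff it is balanced and connected.

Let `F a` be the generating function of the positions at which `a` is read. Balance says `∑ F a * (X
^ c a - 1) = 0`; dividing by `X - 1` gives `∑_I F i * seg (c i) = ∑_J F j * seg (c j)`. Both sides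
count the crossings of each unit interval `[n, n + 1]`, upwards and downwards, and the common value
plays the role of `f_S`. Conditions (ii) and (iii) say that the loops (letters of K) sit between the
lowest and the highest vertex of these crossed intervals. Splitting the common value into pair
weights with marginals `F i * seg (c i)` and `F j * seg (c j)` (`exists_transport`) turns `∑ F a *
y_{a,m}` into the equations with `h_{(i,j),m}`, whose denominators are the segments.

Conversely, clearing denominators in a solution yields positive `F a`
(`IsPairSolution.exists_isPosSolution`). Two gaps remain. Connectedness: after multiplication by a
long segment `1 + X + ⋯ + X ^ M` all supports are long intervals, and steps with gcd 1 connect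
everything (`exists_forall_interval_const`). Integrality: a suitable additive map `ℝ → ℚ` replaces
the coefficients by natural numbers without changing supports or breaking integral linear relations
(`exists_multiset_of_nonnegCoeff`). -/

namespace ZWrZ

open LaurentPolynomial

/-! ### Eulerian circuits of directed multigraphs -/

section Euler

variable {E V : Type*}

/-- `l` is a walk from `u` to `v`, where the edge `e` leads from `s e` to `t e`. -/
def IsWalk (s t : E → V) : V → List E → V → Prop
  | u, [], v => u = v
  | u, e :: l, v => s e = u ∧ IsWalk s t (t e) l v

variable {s t : E → V}

theorem isWalk_append {u v : V} {l l' : List E} :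
    IsWalk s t u (l ++ l') v ↔ ∃ w, IsWalk s t u l w ∧ IsWalk s t w l' v := by
  induction l generalizing u with
  | nil => simp [IsWalk]
  | cons e l ih => simp [IsWalk, ih]; grind

theorem IsWalk.concat {u : V} {l : List E} {e : E} (h : IsWalk s t u l (s e)) :
    IsWalk s t u (l ++ [e]) (t e) :=
  isWalk_append.2 ⟨_, h, rfl, rfl⟩

/-- Every intermediate vertex is entered once for each time it is left; the two endpoints account
for the extra terms. -/
theorem IsWalk.balance {u v : V} {l : List E} (h : IsWalk s t u l v) :
    v ::ₘ (l : Multiset E).map s = u ::ₘ (l : Multiset E).map t := by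
  induction l generalizing u with
  | nil => cases h; rfl
  | cons e l ih =>
    obtain ⟨rfl, h⟩ := h
    rw [← Multiset.cons_coe, Multiset.map_cons, Multiset.map_cons, Multiset.cons_swap, ih h]

theorem IsWalk.map_eq {u : V} {l : List E} (h : IsWalk s t u l u) :
    (l : Multiset E).map s = (l : Multiset E).map t :=
  (Multiset.cons_inj_right _).1 h.balance

/-- A closed walk may be cut open at any of its edges, hence started at any vertex that it visits.
-/
theorem IsWalk.rotate {u : V} {l : List E} (h : IsWalk s t u l u) {e : E} (he : e ∈ l) :
    ∃ l', IsWalk s t (t e) l' (s e) ∧ (e :: l').Perm l := by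
  obtain ⟨l₁, l₂, rfl⟩ := List.append_of_mem he
  obtain ⟨w, h₁, rfl, h₂⟩ := isWalk_append.1 h
  exact ⟨l₂ ++ l₁, isWalk_append.2 ⟨u, h₂, h₁⟩, by
    rw [← List.cons_append]; exact List.perm_append_comm⟩

/-- A closed walk stays inside a set of vertices that no edge leaves, once it meets it. -/
theorem IsWalk.forall_mem_of_closed {u : V} {l : List E} (h : IsWalk s t u l u) {P : V → Prop}
    (hP : ∀ e ∈ l, P (s e) → P (t e)) {e : E} (he : e ∈ l) (hPe : P (s e)) :
    ∀ e' ∈ l, P (s e') := by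
  have aux : ∀ (l' : List E) (u v : V), IsWalk s t u l' v → (∀ e ∈ l', P (s e) → P (t e)) → P u →
      ∀ e ∈ l', P (s e) := by
    intro l'
    induction l' with
    | nil => simp
    | cons a l' ih =>
      rintro u v ⟨rfl, hw⟩ hl hu
      simp only [List.mem_cons, forall_eq_or_imp] at hl ⊢
      exact ⟨hu, ih _ _ hw hl.2 (hl.1 hu)⟩
  obtain ⟨l', hw, hp⟩ := h.rotate he
  intro e' he'
  exact aux (e :: l') (s e) (s e) ⟨rfl, hw⟩ (fun a ha => hP a (hp.subset ha)) hPe e'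
    (hp.symm.subset he')

/-- A balanced and connected directed multigraph has an Eulerian circuit. -/
theorem exists_isWalk_of_balanced {M : Multiset E} (h0 : M ≠ 0) (hb : M.map s = M.map t)
    (hc : ∀ P : V → Prop, (∀ e ∈ M, (P (s e) ↔ P (t e))) → ∀ e ∈ M, P (s e) →
      ∀ e' ∈ M, P (s e')) :
    ∃ (u : V) (l : List E), IsWalk s t u l u ∧ (l : Multiset E) = M := by
  classical
  -- Take a longest walk whose edges, with multiplicity, come from `M`; the leftover edges form `R`.
  -- Neither this walk nor a walk on a rearrangement of its edges can be extended by an edge of `R`.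
  let Q : ℕ → Prop := fun n => ∃ (u : V) (l : List E) (v : V),
    IsWalk s t u l v ∧ (l : Multiset E) ≤ M ∧ l.length = n
  obtain ⟨e₀, he₀⟩ := Multiset.exists_mem_of_ne_zero h0
  have hQ0 : Q 0 := ⟨s e₀, [], s e₀, rfl, by simp, rfl⟩
  have hspec : Q (Nat.findGreatest Q M.card) := Nat.findGreatest_spec (Nat.zero_le _) hQ0
  obtain ⟨u, l, v, hw, hl, hlen⟩ := hspec
  have hmax : ∀ (u' : V) (l' : List E) (v' : V), IsWalk s t u' l' v' → (l' : Multiset E) ≤ M →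
      l'.length ≤ l.length := by
    intro u' l' v' h1 h2
    rw [hlen]
    refine Nat.le_findGreatest ?_ ⟨u', l', v', h1, h2, rfl⟩
    simpa using Multiset.card_le_card h2
  obtain ⟨R, rfl⟩ := Multiset.le_iff_exists_add.1 hl
  have key : ∀ (l' : List E), l'.Perm l → ∀ e ∈ R,
      (¬ ∃ u' v', IsWalk s t u' (l' ++ [e]) v') ∧ ¬ ∃ u' v', IsWalk s t u' (e :: l') v' := by
    intro l' hp e he
    have h1 : ((e :: l' : List E) : Multiset E) ≤ l + R := by
      rw [← Multiset.cons_coe, Multiset.coe_eq_coe.2 hp, ← Multiset.singleton_add, add_comm]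
      exact add_le_add le_rfl (Multiset.singleton_le.2 he)
    have h2 : ((l' ++ [e] : List E) : Multiset E) ≤ l + R := by
      rwa [Multiset.coe_eq_coe.2 (List.perm_append_singleton e l')]
    constructor
    · rintro ⟨u', v', h⟩
      have := hmax _ _ _ h h2
      simp [hp.length_eq] at this
    · rintro ⟨u', v', h⟩
      have := hmax _ _ _ h h1
      simp [hp.length_eq] at this
  -- If the ends differed, balance would leave an unused edge starting at `v`, which could be
  -- appended.
  have huv : u = v := by
    by_contra huv
    have h1 := hw.balance
    have h2 : v ::ₘ R.map t = u ::ₘ R.map s := by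
      rw [Multiset.map_add, Multiset.map_add] at hb
      have h3 : (v ::ₘ (l : Multiset E).map s) + u ::ₘ R.map s =
          (u ::ₘ (l : Multiset E).map t) + v ::ₘ R.map t := by
        simp only [Multiset.cons_add, Multiset.add_cons, hb, Multiset.cons_swap u v]
      rw [h1] at h3
      exact (add_left_cancel h3).symm
    have h4 : v ∈ u ::ₘ R.map s := h2 ▸ Multiset.mem_cons_self _ _
    rcases Multiset.mem_cons.1 h4 with h | h
    · exact huv h.symm
    · obtain ⟨e, he, rfl⟩ := Multiset.mem_map.1 h
      exact (key l (List.Perm.refl _) e he).1 ⟨_, _, hw.concat⟩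
  subst huv
  refine ⟨u, l, hw, ?_⟩
  by_contra hR
  have hR0 : R ≠ 0 := by rintro rfl; simp at hR
  obtain ⟨e₁, he₁⟩ := Multiset.exists_mem_of_ne_zero hR0
  rcases List.eq_nil_or_concat l with rfl | ⟨l', e₂, hl2⟩
  · exact (key [] (List.Perm.refl _) e₁ he₁).2 ⟨s e₁, t e₁, rfl, rfl⟩
  have he₂ : e₂ ∈ l := by simp [hl2]
  have hst : ∀ x, (∃ e ∈ l, s e = x) ↔ ∃ e ∈ l, t e = x := by
    intro x
    have := congrArg (x ∈ ·) hw.map_eq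
    simpa [Multiset.mem_map] using this
  have hRs : ∀ e ∈ R, ¬ ∃ e' ∈ l, s e' = s e := by
    rintro e he ⟨e', he', h⟩
    obtain ⟨l', hw', hp⟩ := hw.rotate he'
    refine (key _ hp e he).1 ⟨s e', t e, IsWalk.concat ?_⟩
    rw [← h]
    exact ⟨rfl, hw'⟩
  have hRt : ∀ e ∈ R, ¬ ∃ e' ∈ l, s e' = t e := by
    rintro e he ⟨e', he', h⟩
    obtain ⟨l', hw', hp⟩ := hw.rotate he'
    refine (key _ hp e he).2 ⟨s e, s e', rfl, ?_⟩
    rw [← h]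
    exact ⟨rfl, hw'⟩
  -- No leftover edge touches a visited vertex, since the circuit could be rotated to that vertex
  -- and extended. So the set of visited vertices separates `l` from `R`, against connectedness.
  refine hRs e₁ he₁ (hc (fun x => ∃ e' ∈ l, s e' = x) ?_ e₂ (by simp [he₂]) ⟨e₂, he₂, rfl⟩ e₁
    (by simp [he₁]))
  intro e he
  rcases Multiset.mem_add.1 he with h | h
  · exact iff_of_true ⟨e, h, rfl⟩ ((hst _).2 ⟨e, h, rfl⟩)
  · exact iff_of_false (hRs e h) (hRt e h)

end Euler

/-! ### Semigroups that are groups -/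

theorem mem_closure_range_iff {A G : Type*} [Group G] (g : A → G) (x : G) :
    x ∈ Subsemigroup.closure (Set.range g) ↔ ∃ l : List A, l ≠ [] ∧ (l.map g).prod = x := by
  constructor
  · intro hx
    induction hx using Subsemigroup.closure_induction with
    | mem x h =>
      obtain ⟨a, rfl⟩ := h
      exact ⟨[a], by simp, by simp⟩
    | mul x y _ _ hx hy =>
      obtain ⟨l, h, rfl⟩ := hx
      obtain ⟨l', -, rfl⟩ := hy
      exact ⟨l ++ l', by simp [h], by simp⟩
  · rintro ⟨l, hl, rfl⟩
    induction l with
    | nil => exact absurd rfl hl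
    | cons a l ih =>
      have ha : g a ∈ Subsemigroup.closure (Set.range g) :=
        Subsemigroup.subset_closure ⟨a, rfl⟩
      rcases eq_or_ne l [] with rfl | h
      · simpa using ha
      · simpa using mul_mem ha (ih h)

/-- A finitely generated subsemigroup of a group is a group if and only if some word that contains
all generators represents the neutral element. -/
theorem isGroupSemigroup_closure_iff {A G : Type*} [Group G] [Fintype A] [Nonempty A] (g : A → G) :
    IsGroupSemigroup (Subsemigroup.closure (Set.range g)) ↔
      ∃ l : List A, (∀ a, a ∈ l) ∧ (l.map g).prod = 1 := by
  constructor
  · rintro ⟨e, he, h⟩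
    have he1 : e = 1 := by simpa using (h e he).1
    subst he1
    have h1 : ∀ a, ∃ l : List A, g a * (l.map g).prod = 1 := by
      intro a
      obtain ⟨x', hx', -, h2⟩ := (h (g a) (Subsemigroup.subset_closure ⟨a, rfl⟩)).2.2
      obtain ⟨l, -, rfl⟩ := (mem_closure_range_iff g x').1 hx'
      exact ⟨l, h2⟩
    choose w hw using h1
    -- Concatenate, over all letters `a`, the trivial words formed by `a` and a word for the inverse
    -- of `g a`.
    refine ⟨(Finset.univ : Finset A).toList.flatMap fun a => a :: w a, fun a => ?_, ?_⟩
    · simp only [List.mem_flatMap, Finset.mem_toList]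
      exact ⟨a, Finset.mem_univ _, by simp⟩
    · generalize (Finset.univ : Finset A).toList = L
      induction L with
      | nil => simp
      | cons a L ih => simp [ih, hw]
  · rintro ⟨l, hl, h⟩
    obtain ⟨a₀⟩ := ‹Nonempty A›
    have hne : l ≠ [] := List.ne_nil_of_mem (hl a₀)
    refine ⟨1, (mem_closure_range_iff g 1).2 ⟨l, hne, h⟩, fun x hx => ⟨by simp, by simp, ?_⟩⟩
    suffices x⁻¹ ∈ Subsemigroup.closure (Set.range g) from ⟨x⁻¹, this, by simp, by simp⟩
    induction hx using Subsemigroup.closure_induction with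
    | mem x hx =>
      obtain ⟨a, rfl⟩ := hx
      obtain ⟨l₁, l₂, rfl⟩ := List.append_of_mem (hl a)
      -- From `l₁ a l₂ = 1` the inverse of `g a` is `l₂ l₁`; the trivial word `l` is inserted in the
      -- middle only to keep the word nonempty.
      refine (mem_closure_range_iff g _).2 ⟨l₂ ++ (l₁ ++ a :: l₂) ++ l₁, by simp, ?_⟩
      simp only [List.map_append, List.map_cons, List.prod_append, List.prod_cons] at h ⊢
      rw [h, mul_one, eq_inv_of_mul_eq_one_left h]
      group
    | mul x y _ _ hx hy =>
      rw [mul_inv_rev]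
      exact mul_mem hy hx

/-! ### Predicates on long intervals with several periods -/

/-- For `t` in the subgroup generated by the steps `c a`, a predicate on a long interval that is
invariant under all the steps inside the interval is invariant under `t` away from the ends. -/
theorem exists_margin {A : Type*} {B : Finset A} {c : A → ℤ} {t : ℤ}
    (ht : t ∈ AddSubgroup.closure (c '' B)) :
    ∃ R : ℤ, 0 ≤ R ∧ ∀ (L U : ℤ) (P : ℤ → Prop),
      (∀ a ∈ B, ∀ v, L ≤ v → v ≤ U → L ≤ v + c a → v + c a ≤ U → (P v ↔ P (v + c a))) →
      ∀ v, L + R ≤ v → v + R ≤ U → (P v ↔ P (v + t)) := by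
  induction ht using AddSubgroup.closure_induction with
  | mem x hx =>
    obtain ⟨a, ha, rfl⟩ := hx
    refine ⟨|c a|, abs_nonneg _, fun L U P hP v h1 h2 => ?_⟩
    have := neg_abs_le (c a)
    have := le_abs_self (c a)
    exact hP a ha v (by linarith) (by linarith) (by linarith) (by linarith)
  | zero => exact ⟨0, le_rfl, fun L U P _ v _ _ => by simp⟩
  | add x z _ _ hx hz =>
    obtain ⟨R, hR, hx⟩ := hx
    obtain ⟨R', hR', hz⟩ := hz
    -- The second invariance is applied at `v + x`, which must still keep distance `R'` from both
    -- ends.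
    refine ⟨R + R' + |x|, by positivity, fun L U P hP v h1 h2 => ?_⟩
    have := neg_abs_le x
    have := le_abs_self x
    rw [hx L U P hP v (by linarith) (by linarith),
      hz L U P hP (v + x) (by linarith) (by linarith), add_assoc]
  | neg x _ hx =>
    obtain ⟨R, hR, hx⟩ := hx
    refine ⟨R + |x|, by positivity, fun L U P hP v h1 h2 => ?_⟩
    have := neg_abs_le x
    have := le_abs_self x
    rw [hx L U P hP (v + -x) (by linarith) (by linarith)]
    simp

/-- If the steps `c a` generate `ℤ`, then a predicate that is invariant under each of the steps on
a long interval, depending on the step, is constant on the union of the intervals. -/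
theorem exists_forall_interval_const {A : Type*} {B : Finset A} {c : A → ℤ}
    (hB : ∀ a ∈ B, c a ≠ 0) (h1 : (1 : ℤ) ∈ AddSubgroup.closure (c '' B)) (l u : A → ℤ) :
    ∃ M₀ : ℕ, ∀ M : ℕ, M₀ ≤ M → ∀ P : ℤ → Prop,
      (∀ a ∈ B, ∀ v, l a ≤ v → v + |c a| ≤ u a + M → (P v ↔ P (v + |c a|))) →
      ∀ v w : ℤ, (∃ a ∈ B, l a ≤ v) → (∃ a ∈ B, v ≤ u a + M) →
        (∃ a ∈ B, l a ≤ w) → (∃ a ∈ B, w ≤ u a + M) → (P v ↔ P w) := by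
  obtain ⟨R, hR, hstep⟩ := exists_margin h1
  obtain ⟨K, hK0, hK⟩ : ∃ K : ℤ, 0 ≤ K ∧ ∀ a ∈ B, |c a| ≤ K ∧ |l a| ≤ K ∧ |u a| ≤ K := by
    refine ⟨∑ a ∈ B, (|c a| + |l a| + |u a|), by positivity, fun a ha => ?_⟩
    have := Finset.single_le_sum (f := fun a => |c a| + |l a| + |u a|)
      (fun _ _ => by positivity) ha
    have := abs_nonneg (c a)
    have := abs_nonneg (l a)
    have := abs_nonneg (u a)
    refine ⟨?_, ?_, ?_⟩ <;> linarith
  -- With this bound the middle zone `[K + R, M - K - R]` is longer than every step, so jumps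
  -- towards it from either side cannot pass over it.
  refine ⟨(2 * R + 4 * K + 4).toNat, fun M hM P hP => ?_⟩
  have hM' : 2 * R + 4 * K + 4 ≤ (M : ℤ) := by omega
  have bd : ∀ a ∈ B, 0 < |c a| ∧ |c a| ≤ K ∧ -K ≤ l a ∧ l a ≤ K ∧ -K ≤ u a ∧ u a ≤ K := by
    intro a ha
    obtain ⟨h1, h2, h3⟩ := hK a ha
    exact ⟨abs_pos.2 (hB a ha), h1, (abs_le.1 h2).1, (abs_le.1 h2).2, (abs_le.1 h3).1,
      (abs_le.1 h3).2⟩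
  -- The interval `[K, M - K]` lies inside the intervals of all the steps, so away from its ends the
  -- predicate is invariant under 1.
  have hsucc : ∀ v, K + R ≤ v → v + R ≤ M - K → (P v ↔ P (v + 1)) := by
    refine hstep K (M - K) P fun a ha v h1 h2 h3 h4 => ?_
    obtain ⟨b1, b2, b3, b4, b5, b6⟩ := bd a ha
    rcases abs_choice (c a) with h | h
    · have := hP a ha v (by linarith) (by linarith)
      rwa [h] at this
    · have := hP a ha (v + c a) (by linarith) (by rw [h]; linarith)
      rw [h, add_neg_cancel_right] at this
      exact this.symm
  have hmid : ∀ n : ℕ, K + R + n + R ≤ M - K + 1 → (P (K + R) ↔ P (K + R + n)) := by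
    intro n
    induction n with
    | zero => simp
    | succ n ih =>
      intro h
      push_cast at h ⊢
      rw [ih (by linarith), hsucc _ (by omega) (by linarith), add_assoc]
  have hmid' : ∀ v, K + R ≤ v → v + R ≤ M - K → (P v ↔ P (K + R)) := by
    intro v h1 h2
    have := hmid (v - (K + R)).toNat (by omega)
    rw [this, Int.toNat_of_nonneg (by linarith)]
    simp
  -- Points left of the middle zone are carried into it by repeated jumps of length `|c a|`, for one
  -- `a` whose interval starts before the point.
  have hup : ∀ n : ℕ, ∀ a ∈ B, ∀ v, l a ≤ v → v ≤ M - K - R → K + R - v ≤ n →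
      (P v ↔ P (K + R)) := by
    intro n
    induction n with
    | zero => exact fun a ha v h1 h2 h3 => hmid' v (by simp at h3; linarith) (by linarith)
    | succ n ih =>
      intro a ha v h1 h2 h3
      obtain ⟨b1, b2, b3, b4, b5, b6⟩ := bd a ha
      by_cases h : K + R ≤ v
      · exact hmid' v h (by linarith)
      · rw [hP a ha v h1 (by linarith)]
        exact ih a ha _ (by linarith) (by linarith) (by push_cast at h3; linarith)
  have hdown : ∀ n : ℕ, ∀ a ∈ B, ∀ v, K + R ≤ v → v ≤ u a + M → v - (M - K - R) ≤ n →
      (P v ↔ P (K + R)) := by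
    intro n
    induction n with
    | zero => exact fun a ha v h1 h2 h3 => hmid' v h1 (by simp at h3; linarith)
    | succ n ih =>
      intro a ha v h1 h2 h3
      obtain ⟨b1, b2, b3, b4, b5, b6⟩ := bd a ha
      by_cases h : v ≤ M - K - R
      · exact hmid' v h1 (by linarith)
      · have := hP a ha (v - |c a|) (by linarith) (by linarith)
        rw [sub_add_cancel] at this
        rw [← this]
        exact ih a ha _ (by linarith) (by linarith) (by push_cast at h3; linarith)
  have hall : ∀ v : ℤ, (∃ a ∈ B, l a ≤ v) → (∃ a ∈ B, v ≤ u a + M) → (P v ↔ P (K + R)) := by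
    rintro v ⟨a, ha, h1⟩ ⟨a', ha', h2⟩
    rcases le_total v (M - K - R) with h | h
    · exact hup (K + R - v).toNat a ha v h1 h (Int.self_le_toNat _)
    · exact hdown (v - (M - K - R)).toNat a' ha' v (by linarith) h2 (Int.self_le_toNat _)
  intro v w h1 h2 h3 h4
  rw [hall v h1 h2, hall w h3 h4]

/-! ### Additive functions on the reals with prescribed natural values -/

/-- There is an additive function from `ℝ` to `ℚ` with positive integer values on a given finite
set of positive numbers. -/
theorem exists_addMonoidHom_pos (X : Finset ℝ) (hX : ∀ x ∈ X, 0 < x) :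
    ∃ φ : ℝ →+ ℚ, ∀ x ∈ X, ∃ k : ℕ, 0 < k ∧ φ x = k := by
  obtain ⟨ψ, hψ⟩ : ∃ ψ : ℝ →ₗ[ℚ] ℚ, ∀ x ∈ X, 0 < ψ x := by
    let B := Module.Basis.ofVectorSpace ℚ ℝ
    -- Sending each element of a ℚ-basis of ℝ to a rational within `ε` of it moves `x` by at most `ε
    -- * w x`; this is less than `x` for all `x ∈ X` once `ε` is small, so positivity survives.
    let w : ℝ → ℝ := fun x => ∑ k ∈ (B.repr x).support, |(B.repr x k : ℝ)|
    have hw : ∀ x, 0 ≤ w x := fun x => Finset.sum_nonneg fun _ _ => abs_nonneg _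
    obtain ⟨ε, hε, hεX⟩ : ∃ ε : ℝ, 0 < ε ∧ ∀ x ∈ X, ε * w x < x := by
      have : ∀ x ∈ X, ∀ᶠ ε : ℝ in nhdsWithin 0 (Set.Ioi 0), ε * w x < x := by
        intro x hx
        have : Filter.Tendsto (fun ε : ℝ => ε * w x) (nhdsWithin 0 (Set.Ioi 0)) (nhds 0) := by
          have h : Filter.Tendsto (fun ε : ℝ => ε * w x) (nhds 0) (nhds (0 * w x)) :=
            (continuous_id.mul continuous_const).tendsto 0
          rw [zero_mul] at h
          exact h.mono_left nhdsWithin_le_nhds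
        exact this.eventually (gt_mem_nhds (hX x hx))
      have h := (Filter.eventually_all_finset X).2 this
      obtain ⟨ε, h1, h2⟩ := (h.and self_mem_nhdsWithin).exists
      exact ⟨ε, h2, h1⟩
    have hq : ∀ k, ∃ q : ℚ, |B k - q| < ε := fun k => by
      obtain ⟨q, h1, h2⟩ := exists_rat_btwn (sub_lt_self (B k) hε)
      exact ⟨q, by rw [abs_lt]; constructor <;> linarith⟩
    choose q hq using hq
    refine ⟨B.constr ℚ q, fun x hx => ?_⟩
    have h1 : ((B.constr ℚ q x : ℚ) : ℝ) = ∑ k ∈ (B.repr x).support, (B.repr x k : ℝ) * q k := by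
      rw [Module.Basis.constr_apply, Finsupp.sum]
      push_cast
      simp
    have h2 : x = ∑ k ∈ (B.repr x).support, (B.repr x k : ℝ) * B k := by
      conv_lhs => rw [← B.linearCombination_repr x, Finsupp.linearCombination_apply, Finsupp.sum]
      exact Finset.sum_congr rfl fun k _ => Rat.smul_def _ _
    have h3 : |x - (B.constr ℚ q x : ℚ)| ≤ ε * w x := by
      have h6 : x - (B.constr ℚ q x : ℚ) =
          ∑ k ∈ (B.repr x).support, (B.repr x k : ℝ) * (B k - q k) := by
        simp only [mul_sub, Finset.sum_sub_distrib]
        rw [← h2, h1]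
      rw [h6, Finset.mul_sum]
      refine (Finset.abs_sum_le_sum_abs _ _).trans (Finset.sum_le_sum fun k _ => ?_)
      rw [abs_mul, mul_comm]
      exact mul_le_mul_of_nonneg_right (hq k).le (abs_nonneg _)
    have h4 := (abs_le.1 h3).2
    have h5 := hεX x hx
    have : (0 : ℝ) < (B.constr ℚ q x : ℚ) := by linarith
    exact_mod_cast this
  -- A common denominator makes the positive rational values integers.
  let N : ℕ := ∏ x ∈ X, (ψ x).den
  have hN : 0 < N := Finset.prod_pos fun x _ => (ψ x).den_pos
  refine ⟨N • ψ.toAddMonoidHom, fun x hx => ?_⟩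
  obtain ⟨k, hk⟩ : (ψ x).den ∣ N := Finset.dvd_prod_of_mem (fun x => (ψ x).den) hx
  have hpos := hψ x hx
  have hnum : 0 < (ψ x).num := Rat.num_pos.2 hpos
  have hk0 : 0 < k := Nat.pos_of_ne_zero fun h => by simp [h] at hk; omega
  refine ⟨k * (ψ x).num.toNat, Nat.mul_pos hk0 (by omega), ?_⟩
  have h1 : (((ψ x).num.toNat : ℕ) : ℚ) = (ψ x).num := by
    exact_mod_cast Int.toNat_of_nonneg hnum.le
  have h2 : (N • ψ.toAddMonoidHom) x = N * ψ x := by simp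
  rw [h2, hk]
  push_cast
  rw [h1, mul_comm ((ψ x).den : ℚ), mul_assoc, Rat.den_mul_eq_num]

/-! ### The map `toRat` and the residue parts -/

/-- Multiplication by a power of `X` reduces this to polynomials. It allows identities in `ℝ(X)` to
be read as identities of Laurent polynomials once denominators are cleared. -/
theorem toRat_injective (F : Type*) [Field F] :
    Function.Injective (toRat F : LaurentPolynomial F →+* RatFunc F) := by
  rw [injective_iff_map_eq_zero]
  intro f hf
  obtain ⟨n, p, hp⟩ := exists_T_pow f
  have h : toRat F (Polynomial.toLaurent p) = algebraMap (Polynomial F) (RatFunc F) p := by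
    rw [toRat, eval₂_toLaurent]
    simp only [Algebra.algebraMap_self, RingHom.comp_id, ratX, Units.val_mk0]
    rw [RatFunc.algebraMap_eq_C.symm, ← RatFunc.algebraMap_X, ← Polynomial.aeval_def,
      Polynomial.aeval_algebraMap_apply, Polynomial.aeval_X_left_apply]
  rw [hp, map_mul, hf, zero_mul, eq_comm, map_eq_zero_iff _ (RatFunc.algebraMap_injective F)] at h
  rw [h, map_zero, eq_comm, (isUnit_T (n : ℤ)).mul_left_eq_zero] at hp
  exact hp

/-- Integer Laurent polynomials as Laurent polynomials over `R`. -/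
noncomputable def ofInt (R : Type*) [CommRing R] : LaurentPolynomial ℤ →+* LaurentPolynomial R :=
  AddMonoidAlgebra.mapRingHom ℤ (Int.castRingHom R)

theorem ofInt_coeff {R : Type*} [CommRing R] (f : LaurentPolynomial ℤ) (n : ℤ) :
    (ofInt R f).coeff n = f.coeff n := by
  simp [ofInt]

theorem ofInt_T {R : Type*} [CommRing R] (n : ℤ) : ofInt R (T n) = T n := by
  ext m
  simp [ofInt_coeff]

theorem ofInt_injective {R : Type*} [CommRing R] [CharZero R] :
    Function.Injective (ofInt R) := by
  intro f g h
  ext n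
  have := congrArg (fun p => p.coeff n) h
  simpa [ofInt_coeff] using this

theorem toRat_T (F : Type*) [Field F] {R : Type*} [CommSemiring R] [Algebra R F] (n : ℤ) :
    toRat F (T n : LaurentPolynomial R) = RatFunc.X ^ n := by
  simp [toRat, ratX]

theorem ringHom_ext_of_T {S : Type*} [CommRing S] {f g : LaurentPolynomial ℤ →+* S}
    (h : ∀ n, f (T n) = g (T n)) : f = g := by
  refine RingHom.ext fun p => ?_
  induction p using LaurentPolynomial.induction_on' with
  | add p q hp hq => simp [hp, hq]
  | C_mul_T n a =>
    have : (C a : LaurentPolynomial ℤ) = (a : LaurentPolynomial ℤ) := eq_intCast C a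
    simp [h, this]

theorem toRat_ofInt (F : Type*) [Field F] (f : LaurentPolynomial ℤ) :
    toRat F (ofInt F f) = toRat F f := by
  have : (toRat F).comp (ofInt F) = (toRat F : LaurentPolynomial ℤ →+* RatFunc F) :=
    ringHom_ext_of_T fun n => by simp [ofInt_T, toRat_T]
  exact congrArg (fun φ => φ f) this

theorem ratToReal_X : ratToReal RatFunc.X = RatFunc.X := by
  have h := RatFunc.map_apply_div (Polynomial.mapRingHom (algebraMap ℚ ℝ))
    (nonZeroDivisors_le_comap_nonZeroDivisors_of_injective _
      (Polynomial.map_injective _ (algebraMap ℚ ℝ).injective)) Polynomial.X 1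
  simpa [ratToReal, RatFunc.coe_mapRingHom_eq_coe_map] using h

theorem ratToReal_toRat (f : LaurentPolynomial ℤ) : ratToReal (toRat ℚ f) = toRat ℝ f := by
  have : ratToReal.comp (toRat ℚ) = (toRat ℝ : LaurentPolynomial ℤ →+* RatFunc ℝ) :=
    ringHom_ext_of_T fun n => by simp [toRat_T, ratToReal_X]
  exact congrArg (fun φ => φ f) this

theorem coeff_T_mul {R : Type*} [Semiring R] (k n : ℤ) (f : LaurentPolynomial R) :
    (T k * f).coeff n = f.coeff (n - k) := by
  rw [T, AddMonoidAlgebra.coeff_single_mul_apply, one_mul, neg_add_eq_sub]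

theorem resPart_coeff {d m : ℕ} (hm : m < d) (f : LaurentPolynomial ℤ) (n : ℤ) :
    (resPart d m f).coeff n = f.coeff (d * n + m) := by
  have hd : (0 : ℤ) < d := by omega
  have key : ∀ k : ℤ, (k % (d : ℤ) = m ∧ k / (d : ℤ) = n) ↔ k = d * n + m := by
    intro k
    constructor
    · rintro ⟨h1, h2⟩
      rw [← h1, ← h2, Int.mul_ediv_add_emod]
    · rintro rfl
      constructor
      · rw [Int.mul_add_emod_self_left, Int.emod_eq_of_lt (by omega) (by omega)]
      · rw [Int.mul_add_ediv_left _ _ hd.ne', Int.ediv_eq_zero_of_lt (by omega) (by omega),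
          add_zero]
  rw [resPart, Finsupp.sum, AddMonoidAlgebra.coeff_sum, Finsupp.finsetSum_apply]
  rw [Finset.sum_eq_single (d * n + m)]
  · obtain ⟨h1, h2⟩ := (key _).2 rfl
    rw [if_pos h1, h2, ← single_eq_C_mul_T, AddMonoidAlgebra.coeff_single, Finsupp.single_eq_same]
  · intro k _ hk
    split_ifs with h
    · rw [← single_eq_C_mul_T, AddMonoidAlgebra.coeff_single, Finsupp.single_apply, if_neg]
      exact fun h' => hk ((key k).1 ⟨h, h'⟩)
    · simp
  · intro h
    rw [Finsupp.notMem_support_iff.1 h]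
    simp

theorem resPart_add {d m : ℕ} (hm : m < d) (f g : LaurentPolynomial ℤ) :
    resPart d m (f + g) = resPart d m f + resPart d m g := by
  ext n
  simp [resPart_coeff hm]

theorem resPart_T_mul {d m : ℕ} (hm : m < d) (k : ℤ) (f : LaurentPolynomial ℤ) :
    resPart d m (T (d * k) * f) = T k * resPart d m f := by
  ext n
  simp only [resPart_coeff hm, coeff_T_mul]
  congr 1
  ring

theorem eq_zero_iff_resPart {d : ℕ} (hd : 0 < d) (f : LaurentPolynomial ℤ) :
    f = 0 ↔ ∀ m < d, resPart d m f = 0 := by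
  constructor
  · rintro rfl m -
    simp [resPart]
  · intro h
    ext n
    have hd' : (0 : ℤ) < d := by exact_mod_cast hd
    have h0 := Int.emod_nonneg n hd'.ne'
    have h1 := Int.emod_lt_of_pos n hd'
    have h2 := congrArg (fun p => p.coeff (n / d)) (h (n % (d : ℤ)).toNat (by omega))
    simp only [resPart_coeff (show (n % (d : ℤ)).toNat < d by omega), Int.toNat_of_nonneg h0,
      Int.mul_ediv_add_emod] at h2
    exact h2

/-! ### Words and walks -/

section Walks

variable {A : Type*} {c : A → ℤ}

theorem exists_isWalk_of_word (c : A → ℤ) (l : List A) (u : ℤ) :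
    ∃ (L : List (ℤ × A)) (v : ℤ),
      IsWalk Prod.fst (fun e => e.1 + c e.2) u L v ∧ L.map Prod.snd = l := by
  induction l generalizing u with
  | nil => exact ⟨[], u, rfl, rfl⟩
  | cons a l ih =>
    obtain ⟨L, v, h, rfl⟩ := ih (u + c a)
    exact ⟨(u, a) :: L, v, ⟨rfl, h⟩, rfl⟩

variable {y : A → LaurentPolynomial ℤ} {b : A → ℤ} {d : ℕ}

/-- All shifts in the product are by multiples of `d`, so residue classes do not mix: `X ^ (d * c
a)` acts on each residue part as `X ^ c a`. The factor `T u` accounts for the starting point. -/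
theorem IsWalk.prod_eq (hb : ∀ a, b a = d * c a) {u v : ℤ} {L : List (ℤ × A)}
    (h : IsWalk Prod.fst (fun e => e.1 + c e.2) u L v) :
    ((L.map fun e => (⟨y e.2, b e.2⟩ : ZWrZ)).prod).b = d * (v - u) ∧
      ∀ m < d, T u * resPart d m ((L.map fun e => (⟨y e.2, b e.2⟩ : ZWrZ)).prod).y =
        (L.map fun e => T e.1 * resPart d m (y e.2)).sum := by
  induction L generalizing u with
  | nil =>
    cases h
    simp [one_def, resPart]
  | cons e L ih =>
    obtain ⟨rfl, h⟩ := h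
    obtain ⟨h1, h2⟩ := ih h
    simp only [List.map_cons, List.prod_cons, List.sum_cons, mul_def]
    refine ⟨by rw [h1, hb]; ring, fun m hm => ?_⟩
    rw [← h2 m hm, resPart_add hm, hb, resPart_T_mul hm, mul_add, T_add, mul_assoc]

/-- Words that represent the neutral element correspond to closed walks. -/
theorem exists_word_iff_exists_isWalk (hb : ∀ a, b a = d * c a) (hd : 0 < d) :
    (∃ l : List A, (∀ a, a ∈ l) ∧ (l.map fun a => (⟨y a, b a⟩ : ZWrZ)).prod = 1) ↔
      ∃ (u : ℤ) (L : List (ℤ × A)), IsWalk Prod.fst (fun e => e.1 + c e.2) u L u ∧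
        (∀ a, ∃ v, (v, a) ∈ L) ∧
        ∀ m < d, (L.map fun e => T e.1 * resPart d m (y e.2)).sum = 0 := by
  constructor
  · rintro ⟨l, hl, h⟩
    obtain ⟨L, v, hw, rfl⟩ := exists_isWalk_of_word c l 0
    rw [List.map_map] at h
    obtain ⟨h1, h2⟩ := hw.prod_eq (y := y) hb
    change (L.map fun e => (⟨y e.2, b e.2⟩ : ZWrZ)).prod = 1 at h
    rw [h] at h1 h2
    obtain rfl : v = 0 := by
      simpa [one_def, hd.ne'] using h1.symm
    refine ⟨0, L, hw, fun a => by simpa using hl a, fun m hm => ?_⟩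
    rw [← h2 m hm, one_def, (eq_zero_iff_resPart hd 0).1 rfl m hm, mul_zero]
  · rintro ⟨u, L, hw, hL, h⟩
    obtain ⟨h1, h2⟩ := hw.prod_eq (y := y) hb
    refine ⟨L.map Prod.snd, fun a => by simpa using hL a, ?_⟩
    rw [List.map_map]
    change (L.map fun e => (⟨y e.2, b e.2⟩ : ZWrZ)).prod = 1
    ext1
    · refine (eq_zero_iff_resPart hd _).2 fun m hm => ?_
      have := h2 m hm
      rwa [h m hm, (isUnit_T u).mul_right_eq_zero] at this
    · rw [h1, sub_self, mul_zero]
      rfl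

end Walks

/-! ### Laurent polynomials with nonnegative coefficients -/

/-- The coefficients are nonnegative. -/
def NonnegCoeff (f : LaurentPolynomial ℝ) : Prop := ∀ n, 0 ≤ f.coeff n

theorem isPosLaurent_iff {f : LaurentPolynomial ℝ} :
    IsPosLaurent f ↔ NonnegCoeff f ∧ ∃ n, f.coeff n ≠ 0 := by
  rw [IsPosLaurent, and_comm, NonnegCoeff]
  refine and_congr_right fun _ => ?_
  rw [← not_iff_not]
  push Not
  exact ⟨fun h => by simp [h], fun h => LaurentPolynomial.ext h⟩

theorem coeff_sum_apply {R ι : Type*} [Semiring R] (s : Finset ι) (f : ι → LaurentPolynomial R)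
    (n : ℤ) : (∑ i ∈ s, f i).coeff n = ∑ i ∈ s, (f i).coeff n := by
  rw [AddMonoidAlgebra.coeff_sum, Finsupp.finsetSum_apply]

theorem NonnegCoeff.sum {ι : Type*} {s : Finset ι} {f : ι → LaurentPolynomial ℝ}
    (h : ∀ i ∈ s, NonnegCoeff (f i)) : NonnegCoeff (∑ i ∈ s, f i) := fun n => by
  rw [coeff_sum_apply]
  exact Finset.sum_nonneg fun i hi => h i hi n

theorem NonnegCoeff.sum_ne_zero {ι : Type*} {s : Finset ι} {f : ι → LaurentPolynomial ℝ}
    (h : ∀ i ∈ s, NonnegCoeff (f i)) {n : ℤ} :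
    (∑ i ∈ s, f i).coeff n ≠ 0 ↔ ∃ i ∈ s, (f i).coeff n ≠ 0 := by
  rw [coeff_sum_apply, Ne, Finset.sum_eq_zero_iff_of_nonneg fun i hi => h i hi n]
  push Not
  rfl

theorem NonnegCoeff.mul {f g : LaurentPolynomial ℝ} (hf : NonnegCoeff f) (hg : NonnegCoeff g) :
    NonnegCoeff (f * g) := fun n => by
  rw [AddMonoidAlgebra.coeff_mul_apply_left]
  exact Finset.sum_nonneg fun k _ => mul_nonneg (hf k) (hg _)

/-- Nonnegative terms cannot cancel, so the support of a product is the sumset of the supports. -/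
theorem NonnegCoeff.mul_ne_zero {f g : LaurentPolynomial ℝ} (hf : NonnegCoeff f)
    (hg : NonnegCoeff g) {n : ℤ} :
    (f * g).coeff n ≠ 0 ↔ ∃ k, f.coeff k ≠ 0 ∧ g.coeff (n - k) ≠ 0 := by
  rw [AddMonoidAlgebra.coeff_mul_apply_left, Finsupp.sum, Ne,
    Finset.sum_eq_zero_iff_of_nonneg fun k _ => mul_nonneg (hf k) (hg _)]
  push Not
  constructor
  · rintro ⟨k, -, h⟩
    exact ⟨k, left_ne_zero_of_mul h, by rw [sub_eq_neg_add]; exact right_ne_zero_of_mul h⟩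
  · rintro ⟨k, h1, h2⟩
    exact ⟨k, Finsupp.mem_support_iff.2 h1, _root_.mul_ne_zero h1 (by rwa [sub_eq_neg_add] at h2)⟩

theorem nonnegCoeff_T (n : ℤ) : NonnegCoeff (T n) := fun m => by
  rw [T_apply]
  split_ifs <;> norm_num

theorem IsPosLaurent.mul {f g : LaurentPolynomial ℝ} (hf : IsPosLaurent f)
    (hg : IsPosLaurent g) : IsPosLaurent (f * g) :=
  ⟨_root_.mul_ne_zero hf.1 hg.1, NonnegCoeff.mul hf.2 hg.2⟩

theorem isPosLaurent_one : IsPosLaurent 1 :=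
  ⟨one_ne_zero, by rw [← T_zero]; exact nonnegCoeff_T 0⟩

theorem IsPosLaurent.prod {ι : Type*} {s : Finset ι} {f : ι → LaurentPolynomial ℝ}
    (h : ∀ i ∈ s, IsPosLaurent (f i)) : IsPosLaurent (∏ i ∈ s, f i) := by
  classical
  induction s using Finset.induction_on with
  | empty => simpa using isPosLaurent_one
  | insert a s ha ih =>
    rw [Finset.prod_insert ha]
    exact (h a (by simp)).mul (ih fun i hi => h i (by simp [hi]))

theorem IsPosLaurent.sum {ι : Type*} {s : Finset ι} (hs : s.Nonempty)
    {f : ι → LaurentPolynomial ℝ} (h : ∀ i ∈ s, IsPosLaurent (f i)) :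
    IsPosLaurent (∑ i ∈ s, f i) := by
  obtain ⟨i, hi⟩ := hs
  obtain ⟨n, hn⟩ := (isPosLaurent_iff.1 (h i hi)).2
  exact isPosLaurent_iff.2 ⟨NonnegCoeff.sum fun i hi => (h i hi).2, n,
    (NonnegCoeff.sum_ne_zero fun i hi => (h i hi).2).2 ⟨i, hi, hn⟩⟩

theorem degree_le_degree_add_one_iff {f g : LaurentPolynomial ℝ} :
    f.degree + 1 ≥ g.degree ↔
      ∀ n, g.coeff n ≠ 0 → ∃ k, f.coeff k ≠ 0 ∧ n ≤ k + 1 := by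
  simp only [degree]
  constructor
  · intro h n hn
    have h1 : (n : WithBot ℤ) ≤ f.coeff.support.max + 1 :=
      (Finset.le_max (Finsupp.mem_support_iff.2 hn)).trans h
    rcases hm : f.coeff.support.max with _ | k
    · rw [hm] at h1
      simp [WithBot.none_eq_bot] at h1
    · rw [hm] at h1
      refine ⟨k, Finsupp.mem_support_iff.1 (Finset.mem_of_max hm), ?_⟩
      have h2 : (n : WithBot ℤ) ≤ ((k + 1 : ℤ) : WithBot ℤ) := h1
      exact WithBot.coe_le_coe.1 h2
  · intro h
    refine Finset.max_le fun n hn => ?_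
    obtain ⟨k, hk, hnk⟩ := h n (Finsupp.mem_support_iff.1 hn)
    calc (n : WithBot ℤ) ≤ ((k + 1 : ℤ) : WithBot ℤ) := WithBot.coe_le_coe.2 hnk
      _ = (k : WithBot ℤ) + 1 := rfl
      _ ≤ _ := by
        gcongr
        exact Finset.le_max (Finsupp.mem_support_iff.2 hk)

theorem degMinus_le_degMinus_iff {f g : LaurentPolynomial ℝ} :
    degMinus f ≤ degMinus g ↔ ∀ n, g.coeff n ≠ 0 → ∃ k, f.coeff k ≠ 0 ∧ k ≤ n := by
  simp only [degMinus]
  constructor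
  · intro h n hn
    have h1 : f.coeff.support.min ≤ (n : WithTop ℤ) :=
      h.trans (Finset.min_le (Finsupp.mem_support_iff.2 hn))
    rcases hm : f.coeff.support.min with _ | k
    · rw [hm] at h1
      simp [WithTop.none_eq_top] at h1
    · rw [hm] at h1
      exact ⟨k, Finsupp.mem_support_iff.1 (Finset.mem_of_min hm), WithTop.coe_le_coe.1 h1⟩
  · intro h
    refine Finset.le_min fun n hn => ?_
    obtain ⟨k, hk, hkn⟩ := h n (Finsupp.mem_support_iff.1 hn)
    exact (Finset.min_le (Finsupp.mem_support_iff.2 hk)).trans (WithTop.coe_le_coe.2 hkn)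

/-! ### The segments -/

/-- `1 + X + ⋯ + X ^ (c - 1)` for `c > 0`, and `X ^ (-1) + ⋯ + X ^ (-|c|)` for `c < 0`. -/
noncomputable def seg (R : Type*) [CommRing R] (c : ℤ) : LaurentPolynomial R :=
  ∑ n ∈ Finset.Ico (min 0 c) (max 0 c), T n

theorem sum_Ico_T_mul {R : Type*} [CommRing R] {m n : ℤ} (h : m ≤ n) :
    (∑ k ∈ Finset.Ico m n, T k : LaurentPolynomial R) * (T 1 - 1) = T n - T m := by
  induction n, h using Int.leInduction with
  | base => simp
  | succ n h ih =>
    rw [← Finset.insert_Ico_right_eq_Ico_add_one h, Finset.sum_insert (by simp), add_mul, ih,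
      mul_sub, ← T_add]
    ring

theorem seg_mul_of_pos {R : Type*} [CommRing R] {c : ℤ} (hc : 0 < c) :
    seg R c * (T 1 - 1) = T c - 1 := by
  rw [seg, sum_Ico_T_mul (by simp), max_eq_right hc.le, min_eq_left hc.le, T_zero]

theorem seg_mul_of_neg {R : Type*} [CommRing R] {c : ℤ} (hc : c < 0) :
    seg R c * (T 1 - 1) = -(T c - 1) := by
  rw [seg, sum_Ico_T_mul (by simp), max_eq_left hc.le, min_eq_right hc.le, T_zero, neg_sub]

theorem nonnegCoeff_seg (c : ℤ) : NonnegCoeff (seg ℝ c) :=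
  NonnegCoeff.sum fun n _ => nonnegCoeff_T n

theorem coeff_seg_ne_zero {c n : ℤ} :
    (seg ℝ c).coeff n ≠ 0 ↔ min 0 c ≤ n ∧ n < max 0 c := by
  rw [seg, NonnegCoeff.sum_ne_zero fun n _ => nonnegCoeff_T n]
  simp

theorem isPosLaurent_seg {c : ℤ} (hc : c ≠ 0) : IsPosLaurent (seg ℝ c) :=
  isPosLaurent_iff.2 ⟨nonnegCoeff_seg c, min 0 c, coeff_seg_ne_zero.2 ⟨le_rfl, by grind⟩⟩

theorem ofInt_seg (R : Type*) [CommRing R] (c : ℤ) : ofInt R (seg ℤ c) = seg R c := by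
  simp [seg, ofInt_T]

theorem sum_range_eq_toRat_seg {c : ℤ} (hc : 0 < c) :
    ∑ t ∈ Finset.range c.natAbs, (RatFunc.X : RatFunc ℚ) ^ t = toRat ℚ (seg ℤ c) := by
  rw [seg, map_sum, max_eq_right hc.le, min_eq_left hc.le]
  refine Finset.sum_bij (fun t _ => (t : ℤ)) (fun t ht => ?_) (fun _ _ _ _ h => by simpa using h)
    (fun n hn => ?_) (fun t _ => by rw [toRat_T, zpow_natCast])
  · simp only [Finset.mem_range, Finset.mem_Ico] at *
    omega
  · simp only [Finset.mem_Ico] at hn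
    exact ⟨n.toNat, by simp only [Finset.mem_range]; omega, by omega⟩

theorem sum_Icc_eq_toRat_seg {c : ℤ} (hc : c < 0) :
    ∑ t ∈ Finset.Icc 1 c.natAbs, (RatFunc.X : RatFunc ℚ) ^ (-(t : ℤ)) = toRat ℚ (seg ℤ c) := by
  rw [seg, map_sum, max_eq_left hc.le, min_eq_right hc.le]
  refine Finset.sum_bij (fun t _ => -(t : ℤ)) (fun t ht => ?_)
    (fun _ _ _ _ h => by simpa using h) (fun n hn => ?_) (fun t _ => by rw [toRat_T])
  · simp only [Finset.mem_Icc, Finset.mem_Ico] at *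
    omega
  · simp only [Finset.mem_Ico] at hn
    exact ⟨n.natAbs, by simp only [Finset.mem_Icc]; omega, by omega⟩

/-! ### Positive solutions and closed walks -/

section Passages

variable {A : Type*}

open Classical in
/-- The generating function of the positions at which the letter `a` is used. -/
noncomputable def passages (L : List (ℤ × A)) (a : A) : LaurentPolynomial ℝ :=
  (L.map fun e => if e.2 = a then T e.1 else 0).sum

theorem nonnegCoeff_passages (L : List (ℤ × A)) (a : A) : NonnegCoeff (passages L a) := by
  induction L with
  | nil => intro n; simp [passages]
  | cons e L ih =>
    intro n
    simp only [passages, List.map_cons, List.sum_cons] at ih ⊢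
    rw [AddMonoidAlgebra.coeff_add, Finsupp.add_apply]
    refine add_nonneg ?_ (ih n)
    split_ifs
    · exact nonnegCoeff_T _ n
    · simp

theorem passages_coeff_ne_zero {L : List (ℤ × A)} {a : A} {n : ℤ} :
    (passages L a).coeff n ≠ 0 ↔ (n, a) ∈ L := by
  induction L with
  | nil => simp [passages]
  | cons e L ih =>
    obtain ⟨v, a'⟩ := e
    have h0 : 0 ≤ (passages L a).coeff n := nonnegCoeff_passages L a n
    rw [List.mem_cons, ← ih]
    simp only [passages, List.map_cons, List.sum_cons] at h0 ⊢
    rw [AddMonoidAlgebra.coeff_add, Finsupp.add_apply]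
    by_cases h : a' = a
    · by_cases h' : v = n
      · subst h h'
        simp only [if_true, T_apply, true_or, iff_true]
        linarith
      · have h'' : ¬ n = v := fun h => h' h.symm
        simp [h, h', h'']
    · have h'' : ¬ a = a' := fun h' => h h'.symm
      simp [h, h'']

end Passages

section PosSolution

variable {A : Type*} [Fintype A] {c : A → ℤ} {d : ℕ} {ρ : ℕ → A → LaurentPolynomial ℤ}

theorem mem_idxI {a : A} : a ∈ idxI c ↔ 0 < c a := by simp [idxI]

theorem mem_idxJ {a : A} : a ∈ idxJ c ↔ c a < 0 := by simp [idxJ]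

theorem mem_idxK {a : A} : a ∈ idxK c ↔ c a = 0 := by simp [idxK]

theorem sum_univ_eq_sum_idx {M : Type*} [AddCommMonoid M] (c : A → ℤ) (f : A → M) :
    ∑ a, f a = ∑ i ∈ idxI c, f i + ∑ j ∈ idxJ c, f j + ∑ k ∈ idxK c, f k := by
  simp only [idxI, idxJ, idxK, Finset.sum_filter, ← Finset.sum_add_distrib]
  refine Finset.sum_congr rfl fun a _ => ?_
  rcases lt_trichotomy (c a) 0 with h | h | h
  · simp [h, h.ne, not_lt_of_gt h]
  · simp [h]
  · simp [h, h.ne', not_lt_of_gt h]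

/-- A positive solution of the linear system: the numbers of passages of a closed walk, up to
denominators and connectedness. -/
def IsPosSolution (c : A → ℤ) (d : ℕ) (ρ : ℕ → A → LaurentPolynomial ℤ)
    (F : A → LaurentPolynomial ℝ) : Prop :=
  (∀ a, IsPosLaurent (F a)) ∧ (∀ m < d, ∑ a, F a * ofInt ℝ (ρ m a) = 0) ∧
    ∑ i ∈ idxI c, F i * seg ℝ (c i) = ∑ j ∈ idxJ c, F j * seg ℝ (c j) ∧
    ∀ k ∈ idxK c, ∀ n, (F k).coeff n ≠ 0 →
      (∃ m, (∑ i ∈ idxI c, F i * seg ℝ (c i)).coeff m ≠ 0 ∧ m ≤ n) ∧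
      ∃ m, (∑ i ∈ idxI c, F i * seg ℝ (c i)).coeff m ≠ 0 ∧ n ≤ m + 1

theorem T_one_sub_one_ne_zero : (T 1 - 1 : LaurentPolynomial ℝ) ≠ 0 := by
  intro h
  have := congrArg (fun p => p.coeff 1) h
  simp [← T_zero] at this

/-- Factoring out `X - 1` passes from the balance at vertices to the balance of upward and downward
crossings of unit intervals; loops drop out. -/
theorem sum_mul_T_sub_one (F : A → LaurentPolynomial ℝ) :
    ∑ a, F a * (T (c a) - 1) = (∑ i ∈ idxI c, F i * seg ℝ (c i) -
      ∑ j ∈ idxJ c, F j * seg ℝ (c j)) * (T 1 - 1) := by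
  rw [sum_univ_eq_sum_idx c, sub_mul, Finset.sum_mul, Finset.sum_mul, sub_eq_add_neg,
    ← Finset.sum_neg_distrib]
  have h1 : ∑ k ∈ idxK c, F k * (T (c k) - 1) = 0 :=
    Finset.sum_eq_zero fun k hk => by rw [mem_idxK.1 hk, T_zero, sub_self, mul_zero]
  rw [h1, add_zero]
  congr 1
  · refine Finset.sum_congr rfl fun i hi => ?_
    rw [mul_assoc, seg_mul_of_pos (mem_idxI.1 hi)]
  · refine Finset.sum_congr rfl fun j hj => ?_
    rw [mul_assoc, seg_mul_of_neg (mem_idxJ.1 hj), mul_neg, neg_neg]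

theorem sum_passages_mul (L : List (ℤ × A)) (θ : A → LaurentPolynomial ℝ) :
    ∑ a, passages L a * θ a = (L.map fun e => T e.1 * θ e.2).sum := by
  classical
  induction L with
  | nil => simp [passages]
  | cons e L ih =>
    simp only [passages, List.map_cons, List.sum_cons, add_mul, Finset.sum_add_distrib] at ih ⊢
    rw [ih]
    simp only [ite_mul, zero_mul, Finset.sum_ite_eq, Finset.mem_univ, if_true]

theorem exists_isPosSolution_of_isWalk (hI : (idxI c).Nonempty) {u : ℤ} {L : List (ℤ × A)}
    (hw : IsWalk Prod.fst (fun e => e.1 + c e.2) u L u) (hL : ∀ a, ∃ v, (v, a) ∈ L)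
    (h : ∀ m < d, (L.map fun e => T e.1 * ρ m e.2).sum = 0) :
    ∃ F, IsPosSolution c d ρ F := by
  have hbal : ∑ i ∈ idxI c, passages L i * seg ℝ (c i) =
      ∑ j ∈ idxJ c, passages L j * seg ℝ (c j) := by
    have h1 := sum_mul_T_sub_one (c := c) (passages L)
    have h2 := hw.map_eq
    have h3 := congrArg (fun s => (s.map (T : ℤ → LaurentPolynomial ℝ)).sum) h2
    beta_reduce at h3
    rw [Multiset.map_map, Multiset.map_map] at h3
    rw [sum_passages_mul, ← Multiset.sum_coe, ← Multiset.map_coe] at h1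
    simp only [mul_sub, ← T_add, mul_one, Multiset.sum_map_sub] at h1
    have h4 := h3.symm
    simp only [Function.comp_def] at h4
    rw [h4, sub_self, ← mul_sub_one, eq_comm, mul_eq_zero, or_iff_left T_one_sub_one_ne_zero, sub_eq_zero] at h1
    exact h1
  refine ⟨passages L, fun a => ?_, fun m hm => ?_, hbal, fun k hk n hn => ?_⟩
  · obtain ⟨v, hv⟩ := hL a
    exact isPosLaurent_iff.2 ⟨nonnegCoeff_passages L a, v, passages_coeff_ne_zero.2 hv⟩
  · rw [sum_passages_mul]
    have := congrArg (ofInt ℝ) (h m hm)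
    rw [map_list_sum, List.map_map, map_zero] at this
    rw [← this]
    simp [Function.comp_def, ofInt_T]
  · have hnn : ∀ a, NonnegCoeff (passages L a * seg ℝ (c a)) := fun a =>
      NonnegCoeff.mul (nonnegCoeff_passages L a) (nonnegCoeff_seg _)
    have hne : ∀ (a : A) (p q : ℤ), (p, a) ∈ L → (seg ℝ (c a)).coeff (q - p) ≠ 0 →
        (passages L a * seg ℝ (c a)).coeff q ≠ 0 := fun a p q h1 h2 =>
      (NonnegCoeff.mul_ne_zero (nonnegCoeff_passages L a) (nonnegCoeff_seg _)).2
        ⟨p, passages_coeff_ne_zero.2 h1, h2⟩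
    -- If only loops left `n`, the closed walk could never leave `n`; but it reads a letter of
    -- positive step.
    obtain ⟨a, ha, hca⟩ : ∃ a, (n, a) ∈ L ∧ c a ≠ 0 := by
      by_contra hcon
      push Not at hcon
      obtain ⟨i, hi⟩ := hI
      obtain ⟨v, hv⟩ := hL i
      have h1 := hw.forall_mem_of_closed (P := fun x => x = n)
        (by rintro ⟨x, a⟩ he (rfl : x = n); simp [hcon a he]) (passages_coeff_ne_zero.1 hn) rfl
        _ hv
      simp only at h1
      subst h1
      exact (mem_idxI.1 hi).ne' (hcon i hv)
    suffices ∃ m, (∑ i ∈ idxI c, passages L i * seg ℝ (c i)).coeff m ≠ 0 ∧ m ≤ n ∧ n ≤ m + 1 by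
      obtain ⟨m, h1, h2, h3⟩ := this
      exact ⟨⟨m, h1, h2⟩, m, h1, h3⟩
    -- An upward edge at `n` crosses `[n, n + 1]`, recorded at exponent `n`; a downward one crosses
    -- `[n - 1, n]`, recorded at `n - 1`. This is the source of the `+ 1` in condition (ii).
    rcases lt_or_gt_of_ne hca with hlt | hgt
    · refine ⟨n - 1, ?_, by omega, by omega⟩
      rw [hbal, NonnegCoeff.sum_ne_zero fun a _ => hnn a]
      exact ⟨a, mem_idxJ.2 hlt, hne a n _ ha (coeff_seg_ne_zero.2 (by omega))⟩
    · refine ⟨n, ?_, by omega, by omega⟩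
      rw [NonnegCoeff.sum_ne_zero fun a _ => hnn a]
      exact ⟨a, mem_idxI.2 hgt, hne a n _ ha (coeff_seg_ne_zero.2 (by omega))⟩

/-! ### From positive solutions back to closed walks -/

/-- `φ` is not multiplicative, but additivity suffices to commute with integer factors. -/
theorem map_mul_ofInt (φ : ℝ →+ ℚ) (F : LaurentPolynomial ℝ) (θ : LaurentPolynomial ℤ) :
    AddMonoidAlgebra.map φ (F * ofInt ℝ θ) = AddMonoidAlgebra.map φ F * ofInt ℚ θ := by
  induction θ using LaurentPolynomial.induction_on' with
  | add p q hp hq =>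
    simp only [map_add, mul_add, AddMonoidAlgebra.map_add, hp, hq]
  | C_mul_T n a =>
    ext k
    rw [← single_eq_C_mul_T]
    simp only [ofInt, AddMonoidAlgebra.mapRingHom_single, AddMonoidAlgebra.coeff_map,
      AddMonoidAlgebra.coeff_mul_single_apply, Finsupp.mapRange_apply]
    simp [mul_comm _ (a : ℝ), mul_comm _ (a : ℚ), ← zsmul_eq_mul]

/-- Nonnegative real coefficients can be replaced by natural numbers, with the same supports and
without losing integral linear relations. -/
theorem exists_multiset_of_nonnegCoeff {F : A → LaurentPolynomial ℝ}
    (hF : ∀ a, NonnegCoeff (F a)) :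
    ∃ M : Multiset (ℤ × A), (∀ v a, (v, a) ∈ M ↔ (F a).coeff v ≠ 0) ∧
      ∀ θ : A → LaurentPolynomial ℤ, ∑ a, F a * ofInt ℝ (θ a) = 0 →
        (M.map fun e => T e.1 * θ e.2).sum = 0 := by
  classical
  obtain ⟨φ, hφ⟩ := exists_addMonoidHom_pos
    (Finset.univ.biUnion fun a => (F a).coeff.support.image fun n => (F a).coeff n) (by
      intro x hx
      simp only [Finset.mem_biUnion, Finset.mem_image, Finsupp.mem_support_iff] at hx
      obtain ⟨a, -, n, hn, rfl⟩ := hx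
      exact lt_of_le_of_ne (hF a n) hn.symm)
  have hN : ∀ a n, ∃ k : ℕ, (k ≠ 0 ↔ (F a).coeff n ≠ 0) ∧ φ ((F a).coeff n) = k := by
    intro a n
    by_cases h : (F a).coeff n = 0
    · exact ⟨0, by simp [h]⟩
    · obtain ⟨k, hk, hk'⟩ := hφ ((F a).coeff n) (by
        simp only [Finset.mem_biUnion, Finset.mem_image, Finsupp.mem_support_iff]
        exact ⟨a, Finset.mem_univ _, n, h, rfl⟩)
      exact ⟨k, by simp [h, hk.ne'], hk'⟩
  choose N hN0 hN using hN
  refine ⟨∑ a, ∑ n ∈ (F a).coeff.support, N a n • {(n, a)}, fun v a => ?_, fun θ hθ => ?_⟩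
  · simp only [Multiset.mem_sum, Multiset.mem_nsmul, Multiset.mem_singleton, Prod.mk.injEq,
      Finset.mem_univ, true_and, Finsupp.mem_support_iff]
    constructor
    · rintro ⟨a', n, hn, -, rfl, rfl⟩
      exact hn
    · intro h
      exact ⟨a, v, h, (hN0 a v).2 h, rfl, rfl⟩
  · have key : ∀ f : LaurentPolynomial ℝ, AddMonoidAlgebra.map φ f =
        ∑ n ∈ f.coeff.support, C (φ (f.coeff n)) * T n := by
      intro f
      conv_lhs => rw [← AddMonoidAlgebra.sum_coeff_single f]
      rw [Finsupp.sum, AddMonoidAlgebra.map_sum]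
      simp [← single_eq_C_mul_T]
    have h1 := congrArg (AddMonoidAlgebra.map φ) hθ
    rw [AddMonoidAlgebra.map_sum, AddMonoidAlgebra.map_zero] at h1
    simp only [map_mul_ofInt] at h1
    simp only [key, hN, map_natCast, Finset.sum_mul] at h1
    apply ofInt_injective (R := ℚ)
    rw [map_zero, ← h1, ← Multiset.coe_mapAddMonoidHom, map_sum, ← Multiset.coe_sumAddMonoidHom,
      map_sum, map_sum]
    refine Finset.sum_congr rfl fun a _ => ?_
    rw [map_sum, map_sum, map_sum]
    refine Finset.sum_congr rfl fun n _ => ?_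
    simp only [map_nsmul]
    simp [ofInt_T, mul_assoc]

/-- The coefficients of the sum are the multiplicities. This turns a polynomial identity into the
equality of the multisets of sources and targets. -/
theorem sum_map_T_injective :
    Function.Injective fun s : Multiset ℤ => (s.map (T : ℤ → LaurentPolynomial ℤ)).sum := by
  classical
  have key : ∀ (s : Multiset ℤ) (v : ℤ),
      ((s.map (T : ℤ → LaurentPolynomial ℤ)).sum).coeff v = s.count v := by
    intro s v
    induction s using Multiset.induction_on with
    | empty => simp
    | cons a s ih =>
      rw [Multiset.map_cons, Multiset.sum_cons, AddMonoidAlgebra.coeff_add, Finsupp.add_apply, ih,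
        T_apply, Multiset.count_cons]
      by_cases h : a = v
      · simp [h, add_comm]
      · simp [h, Ne.symm h]
  intro s t h
  ext v
  have h1 := congrArg (fun p => p.coeff v) h
  simp only [key] at h1
  exact_mod_cast h1

/-- A nonnegative Laurent polynomial times a long segment has no gaps. -/
theorem exists_bounds_mul_seg {f : LaurentPolynomial ℝ} (hf : IsPosLaurent f) :
    ∃ α β : ℤ, (∀ n, f.coeff n ≠ 0 → α ≤ n ∧ n ≤ β) ∧ ∀ M : ℕ, β - α ≤ M → ∀ n,
      ((f * seg ℝ (M + 1)).coeff n ≠ 0 ↔ α ≤ n ∧ n ≤ β + M) := by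
  have hs : f.coeff.support.Nonempty := by
    obtain ⟨n, hn⟩ := (isPosLaurent_iff.1 hf).2
    exact ⟨n, Finsupp.mem_support_iff.2 hn⟩
  have hα := Finsupp.mem_support_iff.1 (Finset.min'_mem _ hs)
  have hβ := Finsupp.mem_support_iff.1 (Finset.max'_mem _ hs)
  have hb : ∀ n, f.coeff n ≠ 0 →
      f.coeff.support.min' hs ≤ n ∧ n ≤ f.coeff.support.max' hs := fun n hn =>
    ⟨Finset.min'_le _ _ (Finsupp.mem_support_iff.2 hn),
      Finset.le_max' _ _ (Finsupp.mem_support_iff.2 hn)⟩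
  refine ⟨f.coeff.support.min' hs, f.coeff.support.max' hs, hb, fun M hM n => ?_⟩
  rw [NonnegCoeff.mul_ne_zero hf.2 (nonnegCoeff_seg _)]
  simp only [coeff_seg_ne_zero]
  constructor
  · rintro ⟨k, hk, h1, h2⟩
    have := hb k hk
    omega
  · rintro ⟨h1, h2⟩
    by_cases h : n ≤ f.coeff.support.min' hs + M
    · exact ⟨_, hα, by omega⟩
    · exact ⟨_, hβ, by omega⟩

theorem exists_isWalk_of_isPosSolution (hI : (idxI c).Nonempty)
    (h1 : (1 : ℤ) ∈ AddSubgroup.closure (c '' (Finset.univ.filter fun a => c a ≠ 0 : Finset A)))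
    {F : A → LaurentPolynomial ℝ} (hF : IsPosSolution c d ρ F) :
    ∃ (u : ℤ) (L : List (ℤ × A)), IsWalk Prod.fst (fun e => e.1 + c e.2) u L u ∧
      (∀ a, ∃ v, (v, a) ∈ L) ∧ ∀ m < d, (L.map fun e => T e.1 * ρ m e.2).sum = 0 := by
  obtain ⟨hpos, hρ, hbal, hK⟩ := hF
  choose α β hαβ hseg using fun a => exists_bounds_mul_seg (hpos a)
  -- For large `M` the edges with letter `a` start at the points of `[α a, β a + M]`; the `min` and
  -- `max` enlarge this to include their targets.
  obtain ⟨M₀, hM₀⟩ := exists_forall_interval_const (fun a ha => (Finset.mem_filter.1 ha).2) h1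
    (fun a => α a + min 0 (c a)) (fun a => β a + max 0 (c a))
  obtain ⟨M, hMM, hM⟩ : ∃ M : ℕ, M₀ ≤ M ∧ ∀ a, β a - α a ≤ M := by
    refine ⟨M₀ + ∑ a, (β a - α a).toNat, by omega, fun a => ?_⟩
    have := Finset.single_le_sum (f := fun a => (β a - α a).toNat) (fun _ _ => Nat.zero_le _)
      (Finset.mem_univ a)
    omega
  have hnn : ∀ a, NonnegCoeff (F a * seg ℝ (M + 1)) := fun a =>
    NonnegCoeff.mul (hpos a).2 (nonnegCoeff_seg _)
  obtain ⟨E, hE, hEθ⟩ := exists_multiset_of_nonnegCoeff hnn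
  have hrel : ∀ θ : A → LaurentPolynomial ℤ, ∑ a, F a * ofInt ℝ (θ a) = 0 →
      (E.map fun e => T e.1 * θ e.2).sum = 0 := by
    intro θ hθ
    refine hEθ θ ?_
    rw [Finset.sum_congr rfl fun a _ => mul_right_comm (F a) _ _, ← Finset.sum_mul, hθ, zero_mul]
  have hE' : ∀ v a, (v, a) ∈ E ↔ α a ≤ v ∧ v ≤ β a + M := fun v a => by
    rw [hE, hseg a M (hM a)]
  have hle : ∀ a, α a ≤ β a := fun a => by
    obtain ⟨n, hn⟩ := (isPosLaurent_iff.1 (hpos a)).2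
    exact (hαβ a n hn).1.trans (hαβ a n hn).2
  have hmem : ∀ a, ∃ v, (v, a) ∈ E := fun a =>
    ⟨α a, (hE' _ _).2 ⟨le_rfl, by have := hle a; omega⟩⟩
  -- Balance is itself an integral linear relation, with coefficients `T (c a) - 1`, so it survives
  -- the passage to natural multiplicities.
  have hbalE : E.map Prod.fst = E.map fun e => e.1 + c e.2 := by
    apply sum_map_T_injective
    have := hrel (fun a => T (c a) - 1) (by
      simp only [map_sub, ofInt_T, map_one]
      rw [sum_mul_T_sub_one, hbal, sub_self, zero_mul])
    simp only [mul_sub, ← T_add, mul_one, Multiset.sum_map_sub, sub_eq_zero] at this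
    beta_reduce
    rw [Multiset.map_map, Multiset.map_map]
    exact this.symm
  -- For non-loops this is immediate. For loops the support condition of `IsPosSolution` places each
  -- position of `F a` between vertices touched by non-loops, and the long segment stretches both
  -- ranges alike.
  have hhull : ∀ v a, (v, a) ∈ E →
      (∃ a ∈ (Finset.univ.filter fun a => c a ≠ 0 : Finset A), α a + min 0 (c a) ≤ v) ∧
      ∃ a ∈ (Finset.univ.filter fun a => c a ≠ 0 : Finset A), v ≤ β a + max 0 (c a) + M := by
    intro v a ha
    by_cases hca : c a = 0
    · have h2 := (hE _ _).1 ha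
      rw [NonnegCoeff.mul_ne_zero (hpos a).2 (nonnegCoeff_seg _)] at h2
      obtain ⟨k, hk, h3⟩ := h2
      rw [coeff_seg_ne_zero] at h3
      have hsum : ∀ m, (∑ i ∈ idxI c, F i * seg ℝ (c i)).coeff m ≠ 0 →
          ∃ i, c i ≠ 0 ∧ α i + min 0 (c i) ≤ m ∧ m + 1 ≤ β i + max 0 (c i) := by
        intro m hm
        rw [NonnegCoeff.sum_ne_zero fun i _ =>
          NonnegCoeff.mul (hpos i).2 (nonnegCoeff_seg _)] at hm
        obtain ⟨i, hi, hm⟩ := hm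
        rw [NonnegCoeff.mul_ne_zero (hpos i).2 (nonnegCoeff_seg _)] at hm
        obtain ⟨p, hp, hq⟩ := hm
        rw [coeff_seg_ne_zero] at hq
        have := hαβ i p hp
        have := mem_idxI.1 hi
        exact ⟨i, by omega, by omega, by omega⟩
      obtain ⟨⟨m, hm, hmk⟩, m', hm', hmk'⟩ := hK a (mem_idxK.2 hca) k hk
      obtain ⟨i, hi, hi1, -⟩ := hsum m hm
      obtain ⟨i', hi', -, hi2⟩ := hsum m' hm'
      exact ⟨⟨i, by simpa using hi, by omega⟩, i', by simpa using hi', by omega⟩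
    · have h2 := (hE' _ _).1 ha
      exact ⟨⟨a, by simpa using hca, by omega⟩, a, by simpa using hca, by omega⟩
  obtain ⟨u, L, hw, rfl⟩ := exists_isWalk_of_balanced (s := Prod.fst)
    (t := fun e : ℤ × A => e.1 + c e.2) (M := E)
    (by
      obtain ⟨i, -⟩ := hI
      obtain ⟨v, hv⟩ := hmem i
      rintro rfl
      simp at hv)
    hbalE
    (by
      rintro P hP ⟨v, a⟩ hv hPv ⟨w, a'⟩ hw
      obtain ⟨h3, h4⟩ := hhull v a hv
      obtain ⟨h5, h6⟩ := hhull w a' hw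
      refine (hM₀ M hMM P ?_ v w h3 h4 h5 h6).1 hPv
      intro a ha x h7 h8
      rcases lt_or_gt_of_ne (Finset.mem_filter.1 ha).2 with h | h
      · rw [abs_of_neg h] at h8 ⊢
        have := hP (x + -c a, a) ((hE' _ _).2 (by omega))
        simp only [neg_add_cancel_right] at this
        exact this.symm
      · rw [abs_of_pos h] at h8 ⊢
        exact hP (x, a) ((hE' _ _).2 (by omega)))
  refine ⟨u, L, hw, hmem, fun m hm => ?_⟩
  have := hrel (ρ m) (hρ m hm)
  rwa [Multiset.map_coe, Multiset.sum_coe] at this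

end PosSolution

/-! ### Positive solutions and weights on pairs -/

/-- Two families of nonnegative Laurent polynomials with the same sum are the marginals of a
nonnegative family on the product. -/
theorem exists_transport {A : Type*} {I J : Finset A} {G : A → LaurentPolynomial ℝ}
    (hI : ∀ i ∈ I, NonnegCoeff (G i)) (hJ : ∀ j ∈ J, NonnegCoeff (G j))
    (h : ∑ i ∈ I, G i = ∑ j ∈ J, G j) :
    ∃ f : A × A → LaurentPolynomial ℝ, (∀ p ∈ I ×ˢ J, NonnegCoeff (f p)) ∧
      (∀ i ∈ I, ∑ j ∈ J, f (i, j) = G i) ∧ ∀ j ∈ J, ∑ i ∈ I, f (i, j) = G j := by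
  obtain ⟨s, hs⟩ : ∃ s, s = ∑ i ∈ I, G i := ⟨_, rfl⟩
  have hsI : ∀ n, s.coeff n = ∑ i ∈ I, (G i).coeff n := fun n => by rw [hs, coeff_sum_apply]
  have hsJ : ∀ n, s.coeff n = ∑ j ∈ J, (G j).coeff n := fun n => by
    rw [hs, h, coeff_sum_apply]
  have hs0 : ∀ n, 0 ≤ s.coeff n := fun n => by
    rw [hsI]
    exact Finset.sum_nonneg fun i hi => hI i hi n
  -- Coefficientwise product coupling. Where the total `s` has coefficient zero all `G` vanish too,
  -- so the convention `x / 0 = 0` gives the right value.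
  refine ⟨fun p => AddMonoidAlgebra.ofCoeff (Finsupp.onFinset s.coeff.support
    (fun n => (G p.1).coeff n * (G p.2).coeff n / s.coeff n) fun n hn => ?_), fun p hp n => ?_,
    fun i hi => ?_, fun j hj => ?_⟩
  · exact Finsupp.mem_support_iff.2 fun h0 => hn (by rw [h0, div_zero])
  · obtain ⟨h1, h2⟩ := Finset.mem_product.1 hp
    exact div_nonneg (mul_nonneg (hI _ h1 n) (hJ _ h2 n)) (hs0 n)
  · ext n
    rw [coeff_sum_apply]
    simp only [Finsupp.onFinset_apply, ← Finset.sum_div,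
      ← Finset.mul_sum, ← hsJ]
    by_cases h0 : s.coeff n = 0
    · rw [h0, div_zero]
      rw [hsI, Finset.sum_eq_zero_iff_of_nonneg fun i hi => hI i hi n] at h0
      exact (h0 i hi).symm
    · exact mul_div_cancel_right₀ _ h0
  · ext n
    rw [coeff_sum_apply]
    simp only [Finsupp.onFinset_apply, ← Finset.sum_div,
      ← Finset.sum_mul, ← hsI]
    by_cases h0 : s.coeff n = 0
    · rw [h0, div_zero]
      rw [hsJ, Finset.sum_eq_zero_iff_of_nonneg fun j hj => hJ j hj n] at h0
      exact (h0 j hj).symm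
    · exact mul_div_cancel_left₀ _ h0

theorem sum_product_map_mul_add {A R S : Type*} [CommRing R] [CommRing S] (τ : R →+* S)
    {I J : Finset A} {f : A × A → R} {G : A → R} (hI : ∀ i ∈ I, ∑ j ∈ J, f (i, j) = G i)
    (hJ : ∀ j ∈ J, ∑ i ∈ I, f (i, j) = G j) (x : A → S) :
    ∑ p ∈ I ×ˢ J, τ (f p) * (x p.1 + x p.2) =
      ∑ i ∈ I, τ (G i) * x i + ∑ j ∈ J, τ (G j) * x j := by
  simp only [mul_add, Finset.sum_add_distrib]
  congr 1
  · rw [Finset.sum_product]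
    refine Finset.sum_congr rfl fun i hi => ?_
    rw [← hI i hi, map_sum, Finset.sum_mul]
  · rw [Finset.sum_product_right]
    refine Finset.sum_congr rfl fun j hj => ?_
    rw [← hJ j hj, map_sum, Finset.sum_mul]

section QuotSeg

variable {A : Type*} {c : A → ℤ}

/-- The summand of `h_{(i,j),m}` that belongs to the letter `a`. -/
noncomputable def quotSeg (c : A → ℤ) (θ : A → LaurentPolynomial ℤ) (a : A) : RatFunc ℝ :=
  toRat ℝ (ofInt ℝ (θ a)) / toRat ℝ (seg ℝ (c a))

/-- The marginal weight of a letter is `f * seg (c a)`, so the denominator in `h_{(i,j),m}` cancels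
exactly. -/
theorem toRat_mul_seg_mul_quotSeg {a : A} (ha : c a ≠ 0) (f : LaurentPolynomial ℝ)
    (θ : A → LaurentPolynomial ℤ) :
    toRat ℝ (f * seg ℝ (c a)) * quotSeg c θ a = toRat ℝ (f * ofInt ℝ (θ a)) := by
  have h : toRat ℝ (seg ℝ (c a)) ≠ 0 :=
    (map_ne_zero_iff _ (toRat_injective ℝ)).2 (isPosLaurent_seg ha).1
  rw [quotSeg, map_mul, map_mul]
  field_simp

end QuotSeg

section Weights

variable {A : Type*} [Fintype A] {c : A → ℤ} {d : ℕ} {ρ : ℕ → A → LaurentPolynomial ℤ}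

/-- The conditions of the main theorem, in terms of the normalized steps `c` and the residue
parts `ρ` of the generators. -/
def IsPairSolution (c : A → ℤ) (d : ℕ) (ρ : ℕ → A → LaurentPolynomial ℤ) (S : Finset (A × A))
    (f : A × A → LaurentPolynomial ℝ) (g : A → LaurentPolynomial ℝ) : Prop :=
  DoubleFull c S ∧ (∀ p ∈ S, IsPosLaurent (f p)) ∧ (∀ k ∈ idxK c, IsPosLaurent (g k)) ∧
    (∀ m < d, ∑ p ∈ S, toRat ℝ (f p) * (quotSeg c (ρ m) p.1 + quotSeg c (ρ m) p.2) +
      ∑ k ∈ idxK c, toRat ℝ (g k) * toRat ℝ (ofInt ℝ (ρ m k)) = 0) ∧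
    (∑ p ∈ S, f p).degree + 1 ≥ (∑ k ∈ idxK c, g k).degree ∧
    degMinus (∑ p ∈ S, f p) ≤ degMinus (∑ k ∈ idxK c, g k)

/-- The pair weights couple the families `F i * seg (c i)` and `F j * seg (c j)`, and `S` is the set
of pairs of nonzero weight. It is double-full because no marginal vanishes. -/
theorem IsPosSolution.exists_isPairSolution {F : A → LaurentPolynomial ℝ}
    (hF : IsPosSolution c d ρ F) : ∃ S f g, IsPairSolution c d ρ S f g := by
  classical
  obtain ⟨hpos, hρ, hbal, hK⟩ := hF
  have hG : ∀ a, NonnegCoeff (F a * seg ℝ (c a)) := fun a =>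
    NonnegCoeff.mul (hpos a).2 (nonnegCoeff_seg _)
  have hG0 : ∀ a, c a ≠ 0 → F a * seg ℝ (c a) ≠ 0 := fun a ha =>
    mul_ne_zero (hpos a).1 (isPosLaurent_seg ha).1
  obtain ⟨f, hf, hfI, hfJ⟩ := exists_transport (fun i _ => hG i) (fun j _ => hG j) hbal
  have hS : ∀ {M : Type _} [AddCommMonoid M] (t : A × A → M), (∀ p, f p = 0 → t p = 0) →
      ∑ p ∈ (idxI c ×ˢ idxJ c).filter (fun p => f p ≠ 0), t p = ∑ p ∈ idxI c ×ˢ idxJ c, t p :=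
    fun t ht => Finset.sum_filter_of_ne fun p _ hp h => hp (ht p h)
  have hsum : ∑ p ∈ (idxI c ×ˢ idxJ c).filter (fun p => f p ≠ 0), f p =
      ∑ i ∈ idxI c, F i * seg ℝ (c i) := by
    rw [Finset.sum_filter_ne_zero, Finset.sum_product]
    exact Finset.sum_congr rfl hfI
  refine ⟨(idxI c ×ˢ idxJ c).filter fun p => f p ≠ 0, f, F,
    ⟨Finset.filter_subset _ _, fun i hi => ?_, fun j hj => ?_⟩, fun p hp => ?_,
    fun k _ => hpos k, fun m hm => ?_, ?_, ?_⟩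
  · obtain ⟨j, hj, h⟩ := Finset.exists_ne_zero_of_sum_ne_zero
      (hfI i hi ▸ hG0 i (mem_idxI.1 hi).ne')
    exact ⟨j, hj, by simp [hi, hj, h]⟩
  · obtain ⟨i, hi, h⟩ := Finset.exists_ne_zero_of_sum_ne_zero
      (hfJ j hj ▸ hG0 j (mem_idxJ.1 hj).ne)
    exact ⟨i, hi, by simp [hi, hj, h]⟩
  · obtain ⟨h1, h2⟩ := Finset.mem_filter.1 hp
    exact ⟨h2, hf p h1⟩
  · rw [hS _ fun p hp => by rw [hp, map_zero, zero_mul],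
      sum_product_map_mul_add (toRat ℝ) hfI hfJ]
    have h := congrArg (toRat ℝ) (hρ m hm)
    rw [sum_univ_eq_sum_idx c, map_zero, map_add, map_add, map_sum, map_sum, map_sum] at h
    rw [← h]
    congr 1
    · congr 1
      · exact Finset.sum_congr rfl fun i hi =>
          toRat_mul_seg_mul_quotSeg (mem_idxI.1 hi).ne' _ _
      · exact Finset.sum_congr rfl fun j hj =>
          toRat_mul_seg_mul_quotSeg (mem_idxJ.1 hj).ne _ _
    · exact Finset.sum_congr rfl fun k _ => (map_mul _ _ _).symm
  · rw [degree_le_degree_add_one_iff, hsum]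
    intro n hn
    obtain ⟨k, hk, hn⟩ := (NonnegCoeff.sum_ne_zero fun k _ => (hpos k).2).1 hn
    exact (hK k hk n hn).2
  · rw [degMinus_le_degMinus_iff, hsum]
    intro n hn
    obtain ⟨k, hk, hn⟩ := (NonnegCoeff.sum_ne_zero fun k _ => (hpos k).2).1 hn
    exact (hK k hk n hn).1

/-- The marginals `G a` of the pair weights should equal `F a * seg (c a)`, but need not be
divisible by the segment. Multiplying the whole system by the product `D` of the segments makes them
divisible and keeps all coefficients nonnegative. -/
theorem IsPairSolution.exists_isPosSolution {S : Finset (A × A)} {f : A × A → LaurentPolynomial ℝ}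
    {g : A → LaurentPolynomial ℝ} (h : IsPairSolution c d ρ S f g) :
    ∃ F, IsPosSolution c d ρ F := by
  classical
  obtain ⟨⟨hS, hSI, hSJ⟩, hf, hg, heq, hdeg, hdeg'⟩ := h
  obtain ⟨f', hf'⟩ : ∃ f' : A × A → LaurentPolynomial ℝ, f' = fun p => if p ∈ S then f p else 0 :=
    ⟨_, rfl⟩
  have hfS : ∀ p ∈ S, f' p = f p := fun p hp => by simp [hf', hp]
  have hf0 : ∀ p, p ∉ S → f' p = 0 := fun p hp => by simp [hf', hp]
  have hf'nn : ∀ p, NonnegCoeff (f' p) := fun p => by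
    by_cases hp : p ∈ S
    · rw [hfS p hp]
      exact (hf p hp).2
    · rw [hf0 p hp]
      exact fun n => le_rfl
  obtain ⟨G, hG⟩ : ∃ G : A → LaurentPolynomial ℝ, G = fun a =>
      if 0 < c a then ∑ j ∈ idxJ c, f' (a, j) else ∑ i ∈ idxI c, f' (i, a) := ⟨_, rfl⟩
  have hGI : ∀ i ∈ idxI c, ∑ j ∈ idxJ c, f' (i, j) = G i := fun i hi => by
    simp [hG, mem_idxI.1 hi]
  have hGJ : ∀ j ∈ idxJ c, ∑ i ∈ idxI c, f' (i, j) = G j := fun j hj => by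
    simp [hG, not_lt_of_gt (mem_idxJ.1 hj)]
  have hpos : ∀ (s : Finset A) (q : A → A × A), (∃ a ∈ s, q a ∈ S) →
      IsPosLaurent (∑ a ∈ s, f' (q a)) := by
    rintro s q ⟨a, ha, hq⟩
    obtain ⟨n, hn⟩ := (isPosLaurent_iff.1 (hf _ hq)).2
    refine isPosLaurent_iff.2 ⟨NonnegCoeff.sum fun a _ => hf'nn _, n,
      (NonnegCoeff.sum_ne_zero fun a _ => hf'nn _).2 ⟨a, ha, ?_⟩⟩
    rwa [hfS _ hq]
  have hGpos : ∀ a, c a ≠ 0 → IsPosLaurent (G a) := by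
    intro a ha
    rcases lt_or_gt_of_ne ha with h | h
    · rw [← hGJ a (mem_idxJ.2 h)]
      exact hpos _ _ (hSJ a (mem_idxJ.2 h))
    · rw [← hGI a (mem_idxI.2 h)]
      exact hpos _ _ (hSI a (mem_idxI.2 h))
  have hfsum : ∑ p ∈ S, f p = ∑ p ∈ idxI c ×ˢ idxJ c, f' p := by
    rw [← Finset.sum_subset hS fun p _ hp => hf0 p hp]
    exact Finset.sum_congr rfl fun p hp => (hfS p hp).symm
  have hsI : ∑ i ∈ idxI c, G i = ∑ p ∈ S, f p := by
    rw [hfsum, Finset.sum_product]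
    exact Finset.sum_congr rfl fun i hi => (hGI i hi).symm
  have hsJ : ∑ j ∈ idxJ c, G j = ∑ p ∈ S, f p := by
    rw [hfsum, Finset.sum_product_right]
    exact Finset.sum_congr rfl fun i hi => (hGJ i hi).symm
  obtain ⟨B, hB⟩ : ∃ B : Finset A, ∀ a, a ∈ B ↔ c a ≠ 0 :=
    ⟨Finset.univ.filter fun a => c a ≠ 0, by simp⟩
  obtain ⟨D, hD⟩ : ∃ D, D = ∏ a ∈ B, seg ℝ (c a) := ⟨_, rfl⟩
  have hDpos : IsPosLaurent D := hD ▸ IsPosLaurent.prod fun a ha => isPosLaurent_seg ((hB a).1 ha)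
  obtain ⟨F, hF⟩ : ∃ F : A → LaurentPolynomial ℝ, F = fun a =>
      if c a = 0 then g a * D else G a * ∏ a' ∈ B.erase a, seg ℝ (c a') := ⟨_, rfl⟩
  have hFK : ∀ k ∈ idxK c, F k = g k * D := fun k hk => by simp [hF, mem_idxK.1 hk]
  have hFseg : ∀ a, c a ≠ 0 → F a * seg ℝ (c a) = G a * D := fun a ha => by
    simp only [hF, ha, if_false]
    rw [mul_assoc, Finset.prod_erase_mul _ _ ((hB a).2 ha), hD]
  have hsum : ∑ i ∈ idxI c, F i * seg ℝ (c i) = (∑ p ∈ S, f p) * D := by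
    rw [← hsI, Finset.sum_mul]
    exact Finset.sum_congr rfl fun i hi => hFseg i (mem_idxI.1 hi).ne'
  have hfSnn : NonnegCoeff (∑ p ∈ S, f p) := NonnegCoeff.sum fun p hp => (hf p hp).2
  refine ⟨F, fun a => ?_, fun m hm => ?_, ?_, fun k hk n hn => ?_⟩
  · by_cases ha : c a = 0
    · rw [hFK a (mem_idxK.2 ha)]
      exact (hg a (mem_idxK.2 ha)).mul hDpos
    · simp only [hF, ha, if_false]
      exact (hGpos a ha).mul (IsPosLaurent.prod fun a' ha' =>
        isPosLaurent_seg ((hB a').1 (Finset.mem_of_mem_erase ha')))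
  · apply toRat_injective ℝ
    have h1 := heq m hm
    have h2 : ∑ p ∈ S, toRat ℝ (f p) * (quotSeg c (ρ m) p.1 + quotSeg c (ρ m) p.2) =
        ∑ p ∈ idxI c ×ˢ idxJ c,
          toRat ℝ (f' p) * (quotSeg c (ρ m) p.1 + quotSeg c (ρ m) p.2) := by
      rw [← Finset.sum_subset hS fun p _ hp => by rw [hf0 p hp, map_zero, zero_mul]]
      exact Finset.sum_congr rfl fun p hp => by rw [hfS p hp]
    rw [h2, sum_product_map_mul_add (toRat ℝ) hGI hGJ] at h1
    have h3 := congrArg (· * toRat ℝ D) h1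
    simp only [add_mul, zero_mul, Finset.sum_mul] at h3
    rw [sum_univ_eq_sum_idx c, map_zero, map_add, map_add, map_sum, map_sum, map_sum, ← h3]
    have h4 : ∀ a, c a ≠ 0 → toRat ℝ (F a * ofInt ℝ (ρ m a)) =
        toRat ℝ (G a) * quotSeg c (ρ m) a * toRat ℝ D := fun a ha => by
      rw [← toRat_mul_seg_mul_quotSeg ha, hFseg a ha, map_mul]
      ring
    congr 1
    · congr 1
      · exact Finset.sum_congr rfl fun i hi => h4 i (mem_idxI.1 hi).ne'
      · exact Finset.sum_congr rfl fun j hj => h4 j (mem_idxJ.1 hj).ne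
    · refine Finset.sum_congr rfl fun k hk => ?_
      rw [hFK k hk, map_mul, map_mul]
      ring
  · rw [hsum, ← hsJ, Finset.sum_mul]
    exact (Finset.sum_congr rfl fun j hj => hFseg j (mem_idxJ.1 hj).ne).symm
  · rw [hFK k hk, NonnegCoeff.mul_ne_zero (hg k hk).2 hDpos.2] at hn
    obtain ⟨q, hq, hq'⟩ := hn
    have hq0 : (∑ k ∈ idxK c, g k).coeff q ≠ 0 :=
      (NonnegCoeff.sum_ne_zero fun k hk => (hg k hk).2).2 ⟨k, hk, hq⟩
    have hne : ∀ p, (∑ p ∈ S, f p).coeff p ≠ 0 →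
        (∑ i ∈ idxI c, F i * seg ℝ (c i)).coeff (p + (n - q)) ≠ 0 := fun p hp => by
      rw [hsum, NonnegCoeff.mul_ne_zero hfSnn hDpos.2]
      exact ⟨p, hp, by rwa [add_sub_cancel_left]⟩
    -- The exponent `n` is `q` from `g k` plus `n - q` from `D`; shifting the bounds for `q` by the
    -- same `n - q` gives those for `n`.
    obtain ⟨p, hp, hpq⟩ := degMinus_le_degMinus_iff.1 hdeg' q hq0
    obtain ⟨p', hp', hpq'⟩ := degree_le_degree_add_one_iff.1 hdeg q hq0
    exact ⟨⟨_, hne p hp, by omega⟩, _, hne p' hp', by omega⟩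

end Weights

/-! ### The normalized steps -/

section Steps

variable {A : Type*} [Fintype A] {b : A → ℤ}

theorem stepGcd_dvd (b : A → ℤ) (a : A) : (stepGcd b : ℤ) ∣ b a := by
  by_cases h : b a = 0
  · simp [h]
  · exact Int.natCast_dvd.2 (Finset.gcd_dvd (f := fun a => (b a).natAbs) (by simpa using h))

/-- The subgroup is `gℤ`; then `d * |g|` divides every `b a`, hence their gcd `d`, and `|g| = 1`. -/
theorem one_mem_closure_of_stepGcd {c : A → ℤ} (hd : 0 < stepGcd b)
    (hc : ∀ a, b a = stepGcd b * c a) :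
    (1 : ℤ) ∈ AddSubgroup.closure (c '' (Finset.univ.filter fun a => c a ≠ 0 : Finset A)) := by
  obtain ⟨g, hg⟩ := Int.subgroup_cyclic
    (AddSubgroup.closure (c '' (Finset.univ.filter fun a => c a ≠ 0 : Finset A)))
  have h1 : ∀ a, g ∣ c a := by
    intro a
    by_cases ha : c a = 0
    · simp [ha]
    · have : c a ∈ AddSubgroup.closure
          (c '' (Finset.univ.filter fun a => c a ≠ 0 : Finset A)) :=
        AddSubgroup.subset_closure ⟨a, by simpa using ha, rfl⟩
      rw [hg, AddSubgroup.mem_closure_singleton] at this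
      obtain ⟨n, hn⟩ := this
      exact ⟨n, by rw [← hn, smul_eq_mul, mul_comm]⟩
  have h2 : stepGcd b * g.natAbs ∣ stepGcd b := by
    conv_rhs => rw [stepGcd]
    refine Finset.dvd_gcd fun a _ => ?_
    rw [hc a, Int.natAbs_mul, Int.natAbs_natCast]
    exact mul_dvd_mul_left _ (Int.natAbs_dvd_natAbs.2 (h1 a))
  have h3 : g.natAbs = 1 := by
    have : stepGcd b * g.natAbs ∣ stepGcd b * 1 := by simpa using h2
    exact Nat.dvd_one.1 (Nat.dvd_of_mul_dvd_mul_left hd this)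
  rw [hg, AddSubgroup.mem_closure_singleton]
  rcases Int.natAbs_eq g with h | h <;> rw [h3] at h
  · exact ⟨1, by simp [h]⟩
  · exact ⟨-1, by simp [h]⟩

theorem ratToReal_hRes {c : A → ℤ} (hd : 0 < stepGcd b) (hc : ∀ a, b a = stepGcd b * c a)
    (y : A → LaurentPolynomial ℤ) {i j : A} (hi : 0 < c i) (hj : c j < 0) (m : ℕ) :
    ratToReal (hRes y b i j m) = quotSeg c (fun a => resPart (stepGcd b) m (y a)) i +
      quotSeg c (fun a => resPart (stepGcd b) m (y a)) j := by
  have h : ∀ a, (b a).natAbs / stepGcd b = (c a).natAbs := fun a => by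
    rw [hc a, Int.natAbs_mul, Int.natAbs_natCast, Nat.mul_div_cancel_left _ hd]
  rw [hRes, h, h, sum_range_eq_toRat_seg hi, sum_Icc_eq_toRat_seg hj]
  simp only [quotSeg, map_add, map_div₀, ratToReal_toRat, toRat_ofInt, ← ofInt_seg ℝ]

end Steps

end ZWrZ

/-! ### The main equivalence -/

theorem mainTheorem4 {A : Type*} [Fintype A] (y : A → LaurentPolynomial ℤ) (b : A → ℤ)
    (hI : (ZWrZ.idxI b).Nonempty) (hJ : (ZWrZ.idxJ b).Nonempty) :
    ZWrZ.IsGroupSemigroup (ZWrZ.generated y b) ↔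
      ∃ (S : Finset (A × A)) (fS fK : LaurentPolynomial ℝ)
        (f : A × A → LaurentPolynomial ℝ) (g : A → LaurentPolynomial ℝ),
        ZWrZ.DoubleFull b S ∧
        ZWrZ.IsPosLaurent fS ∧
        ((ZWrZ.idxK b).Nonempty → ZWrZ.IsPosLaurent fK) ∧
        (∀ p ∈ S, ZWrZ.IsPosLaurent (f p)) ∧
        (∀ k ∈ ZWrZ.idxK b, ZWrZ.IsPosLaurent (g k)) ∧
        (∀ m < ZWrZ.stepGcd b,
          ∑ p ∈ S, ZWrZ.toRat ℝ (f p) * ZWrZ.ratToReal (ZWrZ.hRes y b p.1 p.2 m) +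
            ∑ k ∈ ZWrZ.idxK b, ZWrZ.toRat ℝ (g k) * ZWrZ.ratToReal (ZWrZ.yRes y b k m) = 0) ∧
        fS = ∑ p ∈ S, f p ∧
        fK = ∑ k ∈ ZWrZ.idxK b, g k ∧
        fS.degree + 1 ≥ fK.degree ∧
        ZWrZ.degMinus fS ≤ ZWrZ.degMinus fK := by
  have hd := ZWrZ.stepGcd_pos hI
  choose c hc using ZWrZ.stepGcd_dvd b
  have hd' : (0 : ℤ) < ZWrZ.stepGcd b := by exact_mod_cast hd
  have eI : ZWrZ.idxI b = ZWrZ.idxI c := by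
    ext a
    rw [ZWrZ.mem_idxI, ZWrZ.mem_idxI, hc a, mul_pos_iff_of_pos_left hd']
  have eJ : ZWrZ.idxJ b = ZWrZ.idxJ c := by
    ext a
    rw [ZWrZ.mem_idxJ, ZWrZ.mem_idxJ, hc a, ← not_le, ← not_le, mul_nonneg_iff_of_pos_left hd']
  have eK : ZWrZ.idxK b = ZWrZ.idxK c := by
    ext a
    rw [ZWrZ.mem_idxK, ZWrZ.mem_idxK, hc a, mul_eq_zero, or_iff_right hd'.ne']
  have eDF : ∀ S, ZWrZ.DoubleFull b S ↔ ZWrZ.DoubleFull c S := fun S => by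
    rw [ZWrZ.DoubleFull, ZWrZ.DoubleFull, eI, eJ]
  have eq : ∀ (S : Finset (A × A)) (f : A × A → LaurentPolynomial ℝ) (m : ℕ),
      ZWrZ.DoubleFull c S →
      ∑ p ∈ S, ZWrZ.toRat ℝ (f p) * ZWrZ.ratToReal (ZWrZ.hRes y b p.1 p.2 m) =
        ∑ p ∈ S, ZWrZ.toRat ℝ (f p) *
          (ZWrZ.quotSeg c (fun a => ZWrZ.resPart (ZWrZ.stepGcd b) m (y a)) p.1 +
            ZWrZ.quotSeg c (fun a => ZWrZ.resPart (ZWrZ.stepGcd b) m (y a)) p.2) := by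
    intro S f m hS
    refine Finset.sum_congr rfl fun p hp => ?_
    obtain ⟨h1, h2⟩ := Finset.mem_product.1 (hS.1 hp)
    rw [ZWrZ.ratToReal_hRes hd hc y (ZWrZ.mem_idxI.1 h1) (ZWrZ.mem_idxJ.1 h2)]
  have : Nonempty A := ⟨hI.choose⟩
  rw [ZWrZ.generated, ZWrZ.isGroupSemigroup_closure_iff,
    ZWrZ.exists_word_iff_exists_isWalk hc hd]
  simp only [ZWrZ.yRes, ZWrZ.ratToReal_toRat, ← ZWrZ.toRat_ofInt ℝ, eDF]
  rw [eI] at hI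
  rw [eK]
  constructor
  · rintro ⟨u, L, hw, hL, h⟩
    obtain ⟨F, hF⟩ := ZWrZ.exists_isPosSolution_of_isWalk hI
      (ρ := fun m a => ZWrZ.resPart (ZWrZ.stepGcd b) m (y a)) hw hL h
    obtain ⟨S, f, g, hS, hf, hg, heq, hdeg, hdeg'⟩ := hF.exists_isPairSolution
    refine ⟨S, _, _, f, g, hS, ?_, fun hne => ZWrZ.IsPosLaurent.sum hne hg, hf, hg,
      fun m hm => ?_, rfl, rfl, hdeg, hdeg'⟩
    -- `f_S` is nonzero because a double-full set over a nonempty `I` is nonempty.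
    · obtain ⟨i, hi⟩ := hI
      obtain ⟨j, -, hij⟩ := hS.2.1 i hi
      exact ZWrZ.IsPosLaurent.sum ⟨_, hij⟩ hf
    · rw [eq S f m hS]
      exact heq m hm
  · rintro ⟨S, fS, fK, f, g, hS, -, -, hf, hg, heq, rfl, rfl, hdeg, hdeg'⟩
    have hP : ZWrZ.IsPairSolution c (ZWrZ.stepGcd b)
        (fun m a => ZWrZ.resPart (ZWrZ.stepGcd b) m (y a)) S f g :=
      ⟨hS, hf, hg, fun m hm => by rw [← eq S f m hS]; exact heq m hm, hdeg, hdeg'⟩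
    obtain ⟨F, hF⟩ := hP.exists_isPosSolution
    exact ZWrZ.exists_isWalk_of_isPosSolution
      (ρ := fun m a => ZWrZ.resPart (ZWrZ.stepGcd b) m (y a)) hI
      (ZWrZ.one_mem_closure_of_stepGcd hd hc) hF
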